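/- Let $\mathcal X$ be a (second countable) Riemannian manifold of dimension $d$ with Riemannian distance $\mathrm{dist}$, let $\mathrm{Leb}$ be the measure of a volume form on $\mathcal X$ (a Borel measure with continuous, strictly positive density in charts), let $f:\mathcal X\to\mathcal X$ be measurable and let $\mu\ll\mathrm{Leb}$ be an $f$-invariant Borel probability measure. Write $B_\delta(\zeta)=\{x:\mathrm{dist}(x,\zeta)<\delta\}$. Let $\zeta$ be an interior point of $\mathcal X$ (no condition if $\mathcal X$ has no boundary) that is a repelling periodic point of prime period $p\ge1$: $f^p$ is differentiable at $\zeta$ with invertible derivative, $D(f^{-p})(\zeta):=(Df^p(\zeta))^{-1}$ satisfies $0<|\det D(f^{-p})(\zeta)|<1$, and $D(f^{-p})(\zeta)^k v\to0$ as $k\to\infty$ for every tangent vector $v$ (equivalently, all eigenvalues of $Df^p(\zeta)$ have modulus greater than $1$; for $d=1$ this follows from the determinant condition). Put $\theta=1-|\det D(f^{-p})(\zeta)|\in(0,1)$. Assume that $\zeta$ is a Lebesgue point of $\frac{d\mu}{d\mathrm{Leb}}$ with value $\rho\in(0,\infty)$, i.e. $\frac1{\mathrm{Leb}(B_\delta(\zeta))}\int_{B_\delta(\zeta)}\bigl|\frac{d\mu}{d\mathrm{Leb}}-\rho\bigr|\,d\mathrm{Leb}\to0$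 as $\delta\to0^+$. Let $X_i=\varphi\circ f^i$, $i\ge0$, where $\varphi(x)=g(\mathrm{dist}(x,\zeta))$ and $g:[0,\infty)\to\mathbb R\cup\{\pm\infty\}$ has its maximum at $0$ and, for some $\varepsilon>0$ and $w<g(0)$, is a strictly decreasing bijection from $[0,\varepsilon)$ onto $(w,g(0)]$ with $g\le w$ on $[\varepsilon,\infty)$. For $i,s,\ell\ge0$ and $u\in\mathbb R$ put $Q_{p,i}(u)=\{X_i>u,\ X_{i+p}\le u\}$ and $\mathscr Q_{p,s,\ell}(u)=\bigcap_{i=s}^{s+\ell-1}Q_{p,i}(u)^c$. Let $(u_n)$ be real levels with $n\mu(X_0>u_n)\to\tau$ for some $\tau>0$, and assume: * $D^p(u_n)$: there are $\gamma(n,t)$, nonincreasing in $t$, and a sequence of nonnegative integers $t_n=o(n)$ with $n\gamma(n,t_n)\to0$ such that for all nonnegative integers $\ell,t,n$ $$\bigl|\mu(Q_{p,0}(u_n)\cap\mathscr Q_{p,t,\ell}(u_n))-\mu(Q_{p,0}(u_n))\,\mu(\mathscr Q_{p,0,\ell}(u_n))\bigr|\le\gamma(n,t);$$ * $D'_p(u_n)$: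 there are integers $k_n\to\infty$ with $k_nt_n=o(n)$, for this sequence $t_n$, such that $n\sum_{j=1}^{\lfloor n/k_n\rfloor}\mu(Q_{p,0}(u_n)\cap Q_{p,j}(u_n))\to0$. For a Borel set $A$ let $r_A(x)=\min\{j\ge1:f^j(x)\in A\}$ ($=\infty$ if there is no such $j$) and, if $\mu(A)>0$, $\mu_A=\mu(\,\cdot\cap A)/\mu(A)$. Then for every sequence $\delta_n>0$ with $\delta_n\to0$ we have $\mu(B_{\delta_n}(\zeta))\to0$, $$\lim_{n\to\infty}\mu\Bigl(r_{B_{\delta_n}(\zeta)}<\frac t{\mu(B_{\delta_n}(\zeta))}\Bigr)=1-e^{-\theta t}\quad\text{for all }t\ge0,$$ $$\lim_{n\to\infty}\mu_{B_{\delta_n}(\zeta)}\Bigl(r_{B_{\delta_n}(\zeta)}<\frac t{\mu(B_{\delta_n}(\zeta))}\Bigr)=(1-\theta)+\theta\bigl(1-e^{-\theta t}\bigr)\quad\text{for all }t>0,$$ and the same limits hold with $\le$ in place of $<$. -/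

import Mathlib

open MeasureTheory Filter Topology Set Manifold
open scoped ENNReal Asymptotics ContDiff Bundle

noncomputable section

namespace HittingTimes

/-! ### Hitting and return times -/

/-- First hitting time `r_A(x) = min {j ≥ 1 : f^j(x) ∈ A}`, with value `⊤` if there is no such
`j`. -/
def hittingTime {M : Type*} (f : M → M) (A : Set M) (x : M) : ℕ∞ :=
  ⨅ j : {j : ℕ // 1 ≤ j ∧ f^[j] x ∈ A}, ((j : ℕ) : ℕ∞)

/-- The event `r_A ≤ t / μ(A)`. -/
def hitLE {M : Type*} [MeasurableSpace M] (μ : Measure M) (f : M → M) (A : Set M) (t : ℝ) :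
    Set M :=
  {x | ((hittingTime f A x : ℕ∞) : ℝ≥0∞) ≤ ENNReal.ofReal t / μ A}

/-- The event `r_A < t / μ(A)`. -/
def hitLT {M : Type*} [MeasurableSpace M] (μ : Measure M) (f : M → M) (A : Set M) (t : ℝ) :
    Set M :=
  {x | ((hittingTime f A x : ℕ∞) : ℝ≥0∞) < ENNReal.ofReal t / μ A}

/-- Hitting time statistics `G` for the sets `U n`. -/
def HasHTS {M : Type*} [MeasurableSpace M] (μ : Measure M) (f : M → M) (U : ℕ → Set M)
    (G : ℝ → ℝ) : Prop :=
  Tendsto (fun n => μ (U n)) atTop (𝓝 0) ∧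
    ∀ t : ℝ, 0 ≤ t → Tendsto (fun n => μ.real (hitLE μ f (U n) t)) atTop (𝓝 (G t))

/-- Return time statistics `G` for the sets `U n`: the starting point is distributed according to
the conditional measure on `U n`. Since `r ≥ 1`, the law of `r` never charges `t = 0`, whereas the
limit may have an atom there; the convergence is at all `t > 0`. -/
def HasRTS {M : Type*} [MeasurableSpace M] (μ : Measure M) (f : M → M) (U : ℕ → Set M)
    (G : ℝ → ℝ) : Prop :=
  Tendsto (fun n => μ (U n)) atTop (𝓝 0) ∧
    ∀ t : ℝ, 0 < t → Tendsto
      (fun n => (ProbabilityTheory.cond μ (U n)).real (hitLE μ f (U n) t)) atTop (𝓝 (G t))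

/-! ### Escapes and the mixing conditions for a process `X 0, X 1, …` -/

/-- The escape `{X_i > u, X_{i+p} ≤ u}` at time `i`. -/
def escape {M : Type*} (X : ℕ → M → EReal) (p i : ℕ) (u : ℝ) : Set M :=
  {x | (u : EReal) < X i x ∧ X (i + p) x ≤ (u : EReal)}

/-- No escape at the times `s, …, s + ℓ - 1`. -/
def noEscape {M : Type*} (X : ℕ → M → EReal) (p s ℓ : ℕ) (u : ℝ) : Set M :=
  ⋂ i ∈ Finset.Ico s (s + ℓ), (escape X p i u)ᶜ

/-- Condition `D^p(u_n)`, with `T n` the sequence of gaps occurring in it. -/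
def CondDp {M : Type*} [MeasurableSpace M] (μ : Measure M) (X : ℕ → M → EReal) (p : ℕ)
    (u : ℕ → ℝ) (T : ℕ → ℕ) : Prop :=
  (fun n => (T n : ℝ)) =o[atTop] (fun n : ℕ => (n : ℝ)) ∧
  ∃ γ : ℕ → ℕ → ℝ, (∀ n, Antitone (γ n)) ∧
    Tendsto (fun n : ℕ => (n : ℝ) * γ n (T n)) atTop (𝓝 0) ∧
    ∀ n t ℓ : ℕ,
      |μ.real (escape X p 0 (u n) ∩ noEscape X p t ℓ (u n))
        - μ.real (escape X p 0 (u n)) * μ.real (noEscape X p 0 ℓ (u n))| ≤ γ n t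

/-- Condition `D'_p(u_n)`, relative to the gap sequence `T n` of `D^p(u_n)`. -/
def CondDp' {M : Type*} [MeasurableSpace M] (μ : Measure M) (X : ℕ → M → EReal) (p : ℕ)
    (u : ℕ → ℝ) (T : ℕ → ℕ) : Prop :=
  ∃ k : ℕ → ℕ, Tendsto k atTop atTop ∧
    (fun n => (k n : ℝ) * (T n : ℝ)) =o[atTop] (fun n : ℕ => (n : ℝ)) ∧
    Tendsto (fun n : ℕ => (n : ℝ) * ∑ j ∈ Finset.Icc 1 (n / k n),
      μ.real (escape X p 0 (u n) ∩ escape X p j (u n))) atTop (𝓝 0)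

/-! ### Observables -/

/-- The profile `g` of the observable `x ↦ g (dist x ζ)`, a function on `[0, ∞)`: on some
`V = [0, ε)` it is a strictly decreasing bijection onto a one-sided neighbourhood `W = (w, g 0]`
of its maximum, and outside `V` it stays below `W`, so that the sets `{φ > u}` with `u` close to
`g 0` are balls centred at `ζ`. The value `g 0` may be `+∞`. -/
def IsPeak (g : ℝ → EReal) : Prop :=
  ∃ ε > 0, ∃ w < g 0, StrictAntiOn g (Ico 0 ε) ∧ BijOn g (Ico 0 ε) (Ioc w (g 0)) ∧
    ∀ r, ε ≤ r → g r ≤ w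

/-- The process `X_i = φ ∘ f^i` with `φ x = g (dist x ζ)`. -/
def process {M : Type*} [Dist M] (f : M → M) (ζ : M) (g : ℝ → EReal) : ℕ → M → EReal :=
  fun i x => g (dist (f^[i] x) ζ)

/-! ### Lebesgue measure on a manifold, density points, repelling periodic points -/

section Manifold

variable {d : ℕ} {H : Type*} [TopologicalSpace H]
  (I : ModelWithCorners ℝ (EuclideanSpace ℝ (Fin d)) H)
  {M : Type*}

/-- `Leb` is the measure of a volume form: in each chart it has a continuous, strictly positive
density with respect to the Lebesgue measure of `ℝ^d`. -/
def IsVolumeMeasure [TopologicalSpace M] [ChartedSpace H M] [MeasurableSpace M]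
    (Leb : Measure M) : Prop :=
  ∀ x : M, ∃ h : EuclideanSpace ℝ (Fin d) → ℝ,
    ContinuousOn h (extChartAt I x).target ∧ (∀ y ∈ (extChartAt I x).target, 0 < h y) ∧
    ∀ s ⊆ (extChartAt I x).source, MeasurableSet s →
      Leb s = ∫⁻ y in extChartAt I x '' s, ENNReal.ofReal (h y) ∂volume

/-- `ζ` is a Lebesgue point of the density `dμ/dLeb`, where the density has the value `ρ`. -/
def IsLebesguePoint [PseudoMetricSpace M] [MeasurableSpace M] (μ Leb : Measure M) (ζ : M)
    (ρ : ℝ) : Prop :=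
  Tendsto (fun δ : ℝ => (∫⁻ x in Metric.ball ζ δ, ‖(μ.rnDeriv Leb x).toReal - ρ‖ₑ ∂Leb)
    / Leb (Metric.ball ζ δ)) (𝓝[>] 0) (𝓝 0)

/-- `ζ` is a repelling periodic point of prime period `p`, `L` being the (invertible) derivative of
`f^p` at `ζ`, so that `L.symm` is `D(f^{-p})(ζ)`: the determinant of `L.symm` has absolute value
less than `1`, and `L.symm` contracts in the sense that its iterates tend to `0` (all eigenvalues
of `L` lie outside the closed unit disc; for `d = 1` this is the determinant condition again). -/
structure IsRepellingPeriodicPoint [TopologicalSpace M] [ChartedSpace H M]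
    (f : M → M) (p : ℕ) (ζ : M) (L : TangentSpace I ζ ≃L[ℝ] TangentSpace I ζ) : Prop where
  period_pos : 0 < p
  minimalPeriod_eq : Function.minimalPeriod f ζ = p
  hasMFDerivAt : HasMFDerivAt I I f^[p] ζ
    (L : TangentSpace I ζ →L[ℝ] TangentSpace I ζ)
  abs_det_lt : |(L.symm : TangentSpace I ζ →L[ℝ] TangentSpace I ζ).det| < 1
  contracting : ∀ v : TangentSpace I ζ, Tendsto (fun k : ℕ => L.symm^[k] v) atTop (𝓝 0)

end Manifold

end HittingTimes

end

/-!
Seen at the scale `r → 0`, the ball `B_r(ζ)` becomes a linear ball `K` of the tangent space, `f^p`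
becomes its derivative `L`, and `μ` becomes a multiple of Lebesgue measure because `ζ` is a Lebesgue
point. Hence the proportion of `B_r(ζ)` which escapes under `f^p` tends to `|K \ L⁻¹ K| / |K|`,
which is `1 - |det L⁻¹|` as soon as `L⁻¹ K ⊆ K` almost everywhere. The latter holds although `L`
need not expand the Riemannian norm: a violation would make escaped orbits return in a bounded time
with positive probability, against `D'_p`.

Cutting time into blocks, `D^p` and `D'_p` make the number of escapes asymptotically Poissonian, so
avoiding escapes for a time `t / μ(B)` has probability tending to `exp (-θ t)`. Up to an error
`p μ(B)`, avoiding escapes is the same as avoiding `B`. Finally, the probability of avoiding `B` for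
`K` steps is a convex function of `K` whose increments give the law of the return time, so the
return law is the derivative of the hitting law.
-/

noncomputable section

namespace HittingTimes

section Riemannian

variable {E : Type*} [NormedAddCommGroup E] [NormedSpace ℝ E] {H : Type*} [TopologicalSpace H]
  (I : ModelWithCorners ℝ E H) {M : Type*}

section Charts

variable [TopologicalSpace M] [ChartedSpace H M] [IsManifold I 1 M]

lemma mfderivWithin_extChartAt_symm_comp {x : M} {η : ℝ → E} {s : Set ℝ} {t : ℝ}
    (hη : DifferentiableWithinAt ℝ η s t) (hmaps : MapsTo η s (extChartAt I x).target)
    (ht : t ∈ s) (hs : UniqueDiffWithinAt ℝ s t) :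
    mfderiv[s] ((extChartAt I x).symm ∘ η) t 1 =
      (trivializationAt E (TangentSpace I) x).symmL ℝ ((extChartAt I x).symm (η t))
        (derivWithin η s t) := by
  have hsrc : (extChartAt I x).symm (η t) ∈ (chartAt H x).source := by
    simpa only [extChartAt_source] using (extChartAt I x).map_target (hmaps ht)
  have hcomp : mfderiv[s] ((extChartAt I x).symm ∘ η) t =
      (mfderiv[range I] (extChartAt I x).symm (η t)) ∘L (mfderiv[s] η t) :=
    mfderivWithin_comp t (mdifferentiableWithinAt_extChartAt_symm (hmaps ht))
      hη.mdifferentiableWithinAt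
      (fun r hr => extChartAt_target_subset_range x (hmaps hr)) hs.uniqueMDiffWithinAt
  have hone : mfderiv[s] ((extChartAt I x).symm ∘ η) t 1 =
      (mfderiv[range I] (extChartAt I x).symm (η t)) (mfderiv[s] η t 1) :=
    congr($hcomp 1)
  rw [hone, TangentBundle.symmL_trivializationAt hsrc, (extChartAt I x).right_inv (hmaps ht),
    mfderivWithin_eq_fderivWithin]
  rfl

lemma derivWithin_extChartAt_comp {x : M} {γ : ℝ → M} {s : Set ℝ} {t : ℝ}
    (hγ : MDiffAt[s] γ t) (hsrc : γ t ∈ (chartAt H x).source)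
    (hs : UniqueDiffWithinAt ℝ s t) :
    derivWithin (extChartAt I x ∘ γ) s t =
      (trivializationAt E (TangentSpace I) x).continuousLinearMapAt ℝ (γ t)
        (mfderiv[s] γ t 1) := by
  have hcomp : mfderiv[s] (extChartAt I x ∘ γ) t =
      (mfderiv% (extChartAt I x) (γ t)) ∘L (mfderiv[s] γ t) :=
    mfderiv_comp_mfderivWithin t (mdifferentiableAt_extChartAt hsrc) hγ hs.uniqueMDiffWithinAt
  have hone : mfderiv[s] (extChartAt I x ∘ γ) t 1 =
      (mfderiv% (extChartAt I x) (γ t)) (mfderiv[s] γ t 1) := congr($hcomp 1)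
  rw [TangentBundle.continuousLinearMapAt_trivializationAt hsrc]
  refine Eq.trans ?_ hone
  rw [mfderivWithin_eq_fderivWithin]
  rfl

end Charts

lemma dist_lt_of_pathELength_lt [MetricSpace M] [ChartedSpace H M]
    [Bundle.RiemannianBundle (fun x : M => TangentSpace I x)] [IsRiemannianManifold I M]
    {γ : ℝ → M} {c t : ℝ}
    (hγ : CMDiff[Icc 0 1] 1 γ) (hlt : pathELength I γ 0 1 < ENNReal.ofReal c)
    (ht : t ∈ Icc (0 : ℝ) 1) :
    dist (γ 0) (γ t) < c := by
  have hle : riemannianEDist I (γ 0) (γ t) < ENNReal.ofReal c :=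
    ((riemannianEDist_le_pathELength (hγ.mono (Icc_subset_Icc_right ht.2)) rfl rfl ht.1).trans
      (pathELength_mono le_rfl ht.2)).trans_lt hlt
  rw [← IsRiemannianManifold.out, edist_dist] at hle
  exact (ENNReal.ofReal_lt_ofReal_iff_of_nonneg dist_nonneg).1 hle

variable [MetricSpace M] [ChartedSpace H M] [IsManifold I 1 M]
  [Bundle.RiemannianBundle (fun x : M => TangentSpace I x)]

/-- The Riemannian norm at `x`, as a seminorm on the model space: a vector is identified with a
tangent vector by means of the preferred chart at `x`. -/
def chartNorm (x : M) : Seminorm ℝ E :=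
  (normSeminorm ℝ (TangentSpace I x)).comp
    ((trivializationAt E (TangentSpace I) x).symmL ℝ x : E →ₗ[ℝ] TangentSpace I x)

lemma continuous_chartNorm (x : M) : Continuous (chartNorm I x) :=
  ((trivializationAt E (TangentSpace I) x).symmL ℝ x).continuous.norm

lemma exists_norm_le_chartNorm (x : M) : ∃ C > 0, ∀ v, ‖v‖ ≤ C * chartNorm I x v := by
  let G := (trivializationAt E (TangentSpace I) x).continuousLinearMapAt ℝ x
  refine ⟨‖G‖ + 1, by positivity, fun v => ?_⟩
  have hv := G.le_opNorm ((trivializationAt E (TangentSpace I) x).symmL ℝ x v)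
  rw [Bundle.Trivialization.continuousLinearMapAt_symmL _
    (FiberBundle.mem_baseSet_trivializationAt' x)] at hv
  exact hv.trans (by gcongr; exacts [by linarith, le_rfl])

section Continuous

variable [IsContinuousRiemannianBundle E (fun x : M => TangentSpace I x)]

lemma eventually_norm_symmL_le_chartNorm (x : M) {r : ℝ} (hr : 1 < r) :
    ∀ᶠ y in 𝓝 x, ∀ v : E,
      ‖(trivializationAt E (TangentSpace I) x).symmL ℝ y v‖ ≤ r * chartNorm I x v := by
  filter_upwards [eventually_norm_symmL_trivializationAt_comp_self_lt E
    (fun x : M => TangentSpace I x) x hr] with y hy v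
  have hle := ContinuousLinearMap.le_of_opNorm_le _ hy.le
    ((trivializationAt E (TangentSpace I) x).symmL ℝ x v)
  rwa [ContinuousLinearMap.comp_apply, Bundle.Trivialization.continuousLinearMapAt_symmL _
    (FiberBundle.mem_baseSet_trivializationAt' x)] at hle

lemma eventually_chartNorm_continuousLinearMapAt_le (x : M) {r : ℝ} (hr : 1 < r) :
    ∀ᶠ y in 𝓝 x, ∀ v : TangentSpace I y,
      chartNorm I x ((trivializationAt E (TangentSpace I) x).continuousLinearMapAt ℝ y v)
        ≤ r * ‖v‖ := by
  filter_upwards [eventually_norm_symmL_trivializationAt_self_comp_lt E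
    (fun x : M => TangentSpace I x) x hr] with y hy v
  exact ContinuousLinearMap.le_of_opNorm_le _ hy.le v

end Continuous

lemma dist_le_of_segment_subset_target [IsRiemannianManifold I M] {x y z : M} {C : ℝ}
    (hy : y ∈ (chartAt H x).source) (hz : z ∈ (chartAt H x).source)
    (hseg : segment ℝ (extChartAt I x y) (extChartAt I x z) ⊆ (extChartAt I x).target)
    (hC : ∀ q ∈ segment ℝ (extChartAt I x y) (extChartAt I x z),
      ‖(trivializationAt E (TangentSpace I) x).symmL ℝ ((extChartAt I x).symm q)
        (extChartAt I x z - extChartAt I x y)‖ ≤ C) :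
    dist y z ≤ C := by
  let η : ℝ → E := AffineMap.lineMap (extChartAt I x y) (extChartAt I x z)
  have hη_mem : ∀ t ∈ Icc (0 : ℝ) 1, η t ∈ segment ℝ (extChartAt I x y) (extChartAt I x z) :=
    fun t ht => segment_eq_image_lineMap ℝ (extChartAt I x y) _ ▸ mem_image_of_mem _ ht
  have hη_smooth : ContDiff ℝ 1 η := AffineMap.contDiff_lineMap _ _
  have hη_deriv : ∀ t ∈ Icc (0 : ℝ) 1,
      derivWithin η (Icc 0 1) t = extChartAt I x z - extChartAt I x y := fun t ht =>
    AffineMap.hasDerivWithinAt_lineMap.derivWithin (uniqueDiffOn_Icc_zero_one t ht)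
  have hpath : riemannianEDist I y z ≤ pathELength I ((extChartAt I x).symm ∘ η) 0 1 := by
    refine riemannianEDist_le_pathELength ((contMDiffOn_extChartAt_symm x).comp
      hη_smooth.contMDiff.contMDiffOn fun t ht => hseg (hη_mem t ht)) ?_ ?_ zero_le_one
    · simp [η, hy]
    · simp [η, hz]
  have hlength : pathELength I ((extChartAt I x).symm ∘ η) 0 1 ≤ ENNReal.ofReal C := by
    rw [pathELength_eq_lintegral_mfderivWithin_Icc]
    calc _ ≤ ∫⁻ _ in Icc (0 : ℝ) 1, ENNReal.ofReal C :=
          setLIntegral_mono' measurableSet_Icc fun t ht => by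
            rw [mfderivWithin_extChartAt_symm_comp I
              (hη_smooth.differentiable one_ne_zero).differentiableAt.differentiableWithinAt
              (fun s hs => hseg (hη_mem s hs)) ht (uniqueDiffOn_Icc_zero_one t ht),
              hη_deriv t ht, ← ofReal_norm]
            exact ENNReal.ofReal_le_ofReal (hC _ (hη_mem t ht))
      _ = ENNReal.ofReal C := by simp
  have hdist := hpath.trans hlength
  rw [← IsRiemannianManifold.out, edist_dist] at hdist
  exact (ENNReal.ofReal_le_ofReal_iff
    ((norm_nonneg _).trans (hC _ (left_mem_segment ℝ _ _)))).1 hdist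

lemma enorm_sub_le_pathELength {F : Type*} [NormedAddCommGroup F] [NormedSpace ℝ F]
    {x : M} {γ : ℝ → M} {r : ℝ} (hr : 0 ≤ r) (e : E →L[ℝ] F)
    (hγ : CMDiff[Icc 0 1] 1 γ)
    (hsrc : ∀ t ∈ Icc (0 : ℝ) 1, γ t ∈ (chartAt H x).source)
    (hle : ∀ t ∈ Icc (0 : ℝ) 1, ∀ v : TangentSpace I (γ t),
      ‖e ((trivializationAt E (TangentSpace I) x).continuousLinearMapAt ℝ (γ t) v)‖ ≤ r * ‖v‖) :
    ‖e (extChartAt I x (γ 1) - extChartAt I x (γ 0))‖ₑ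
      ≤ ENNReal.ofReal r * pathELength I γ 0 1 := by
  have hsmooth : ContDiffOn ℝ 1 (extChartAt I x ∘ γ) (Icc 0 1) :=
    contMDiffOn_iff_contDiffOn.1 (contMDiffOn_extChartAt.comp hγ hsrc)
  have hder : ∀ t ∈ Icc (0 : ℝ) 1, ‖derivWithin (e ∘ extChartAt I x ∘ γ) (Icc 0 1) t‖ₑ
      ≤ ENNReal.ofReal r * ‖mfderiv[Icc 0 1] γ t 1‖ₑ := fun t ht => by
    have hud := uniqueDiffOn_Icc_zero_one t ht
    rw [(e.hasFDerivAt.comp_hasDerivWithinAt t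
        (hsmooth.differentiableOn one_ne_zero t ht).hasDerivWithinAt).derivWithin hud,
      derivWithin_extChartAt_comp I (hγ.mdifferentiableOn one_ne_zero t ht) (hsrc t ht) hud,
      ← ofReal_norm, ← ofReal_norm, ← ENNReal.ofReal_mul hr]
    exact ENNReal.ofReal_le_ofReal (hle t ht _)
  calc ‖e (extChartAt I x (γ 1) - extChartAt I x (γ 0))‖ₑ
      = ‖(e ∘ extChartAt I x ∘ γ) 1 - (e ∘ extChartAt I x ∘ γ) 0‖ₑ := by
        simp only [Function.comp_apply, map_sub]
    _ ≤ ∫⁻ t in Icc 0 1, ‖derivWithin (e ∘ extChartAt I x ∘ γ) (Icc 0 1) t‖ₑ :=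
        enorm_sub_le_lintegral_derivWithin_Icc_of_contDiffOn_Icc
          (e.contDiff.comp_contDiffOn hsmooth) zero_le_one
    _ ≤ ∫⁻ t in Icc (0 : ℝ) 1, ENNReal.ofReal r * ‖mfderiv[Icc 0 1] γ t 1‖ₑ :=
        setLIntegral_mono' measurableSet_Icc hder
    _ = ENNReal.ofReal r * pathELength I γ 0 1 := by
        rw [lintegral_const_mul' _ _ ENNReal.ofReal_ne_top,
          pathELength_eq_lintegral_mfderivWithin_Icc]

variable [IsContinuousRiemannianBundle E (fun x : M => TangentSpace I x)]
  [IsRiemannianManifold I M]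

lemma eventually_dist_le_chartNorm (x : M) {r : ℝ} (hr : 1 < r) :
    ∀ᶠ y in 𝓝 x, dist x y ≤ r * chartNorm I x (extChartAt I x y - extChartAt I x x) := by
  have hsymm : Tendsto (extChartAt I x).symm (𝓝 (extChartAt I x x)) (𝓝 x) := by
    simpa only [ContinuousAt, extChartAt_to_inv] using continuousAt_extChartAt_symm (I := I) x
  obtain ⟨ρ, ρ_pos, hρ⟩ := Metric.mem_nhdsWithin_iff.1
    (inter_mem (extChartAt_target_mem_nhdsWithin x)
      (nhdsWithin_le_nhds (hsymm.eventually (eventually_norm_symmL_le_chartNorm I x hr))))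
  have hnear : ∀ᶠ y in 𝓝 x, extChartAt I x y ∈ Metric.ball (extChartAt I x x) ρ :=
    (continuousAt_extChartAt x).eventually_mem (Metric.ball_mem_nhds _ ρ_pos)
  filter_upwards [hnear, chart_source_mem_nhds H x] with y hy hy_src
  have hseg : segment ℝ (extChartAt I x x) (extChartAt I x y) ⊆
      Metric.ball (extChartAt I x x) ρ ∩ range I :=
    ((convex_ball _ _).inter I.convex_range).segment_subset
      ⟨Metric.mem_ball_self ρ_pos, mem_range_self _⟩ ⟨hy, mem_range_self _⟩
  exact dist_le_of_segment_subset_target I (mem_chart_source H x) hy_src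
    (fun q hq => (hρ (hseg hq)).1) fun q hq => (hρ (hseg hq)).2 _

lemma eventually_chartNorm_le_dist (x : M) {r : ℝ} (hr : 1 < r) :
    ∀ᶠ y in 𝓝 x, chartNorm I x (extChartAt I x y - extChartAt I x x) ≤ r * dist x y := by
  have hr0 : 0 < r := zero_lt_one.trans hr
  obtain ⟨ε, ε_pos, hε⟩ := Metric.eventually_nhds_iff.1
    ((eventually_chartNorm_continuousLinearMapAt_le I x hr).and (chart_source_mem_nhds H x))
  filter_upwards [Metric.ball_mem_nhds x ε_pos] with y hy
  rw [Metric.mem_ball, dist_comm] at hy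
  have hlt : ∀ c ∈ Ioo (dist x y) ε,
      chartNorm I x (extChartAt I x y - extChartAt I x x) ≤ r * c := by
    intro c hc
    have hedist : riemannianEDist I x y < ENNReal.ofReal c := by
      rw [← IsRiemannianManifold.out, edist_dist]
      exact (ENNReal.ofReal_lt_ofReal_iff_of_nonneg dist_nonneg).2 hc.1
    obtain ⟨γ, rfl, rfl, γ_smooth, hγ, -⟩ :=
      exists_lt_locally_constant_of_riemannianEDist_lt hedist zero_lt_one
    have hmem : ∀ t ∈ Icc (0 : ℝ) 1, dist (γ t) (γ 0) < ε := fun t ht => by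
      rw [dist_comm]
      exact (dist_lt_of_pathELength_lt I γ_smooth.contMDiffOn hγ ht).trans hc.2
    have hle := (enorm_sub_le_pathELength I hr0.le
      ((trivializationAt E (TangentSpace I) (γ 0)).symmL ℝ (γ 0)) γ_smooth.contMDiffOn
      (fun t ht => (hε (hmem t ht)).2) fun t ht => (hε (hmem t ht)).1).trans
        (mul_le_mul_right hγ.le _)
    rw [← ofReal_norm, ← ENNReal.ofReal_mul hr0.le] at hle
    exact (ENNReal.ofReal_le_ofReal_iff (mul_nonneg hr0.le (dist_nonneg.trans hc.1.le))).1 hle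
  have hlim : Tendsto (fun c => r * c) (𝓝[>] dist x y) (𝓝 (r * dist x y)) :=
    (tendsto_const_nhds.mul tendsto_id).mono_left nhdsWithin_le_nhds
  exact ge_of_tendsto hlim (by filter_upwards [Ioo_mem_nhdsGT hy] using hlt)

end Riemannian

section Seminorm

variable {E : Type*} [NormedAddCommGroup E] [NormedSpace ℝ E] {q : Seminorm ℝ E}

lemma isOpen_seminorm_ball (hq : Continuous q) (r : ℝ) : IsOpen (q.ball 0 r) := by
  rw [Seminorm.ball_zero_eq]
  exact isOpen_lt hq continuous_const

variable [MeasurableSpace E] (ν : Measure E) [ν.IsAddHaarMeasure]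

lemma addHaar_seminorm_ball_lt_top [FiniteDimensional ℝ E] {C : ℝ} (hC : 0 < C)
    (hq : ∀ v, ‖v‖ ≤ C * q v) (r : ℝ) :
    ν (q.ball 0 r) < ⊤ :=
  (measure_mono fun v hv => mem_ball_zero_iff.2
    ((hq v).trans_lt (mul_lt_mul_of_pos_left (q.mem_ball_zero.1 hv) hC))).trans_lt
    (measure_ball_lt_top (r := C * r))

lemma addHaar_seminorm_ball_pos (hq : Continuous q) {r : ℝ} (hr : 0 < r) :
    0 < ν (q.ball 0 r) :=
  (isOpen_seminorm_ball hq r).measure_pos ν ⟨0, q.mem_ball_self hr⟩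

lemma ae_seminorm_ne [FiniteDimensional ℝ E] [BorelSpace E] (hq : Continuous q)
    {r : ℝ} (hr : r ≠ 0) : ∀ᵐ v ∂ν, q v ≠ r := by
  have hsphere : {v | q v = r} ⊆ frontier (q.ball 0 r) := fun v hv => by
    rw [(isOpen_seminorm_ball hq r).frontier_eq, Set.mem_sdiff, q.mem_ball_zero]
    refine ⟨mem_closure_of_tendsto (f := fun c : ℝ => c • v) (b := 𝓝[<] 1) ?_ ?_, hv.not_lt⟩
    · have : Continuous fun c : ℝ => c • v := by fun_prop
      simpa only [one_smul] using (this.tendsto 1).mono_left nhdsWithin_le_nhds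
    · have hr0 : 0 < r := hr.symm.lt_of_le (hv ▸ apply_nonneg q v)
      filter_upwards [Ioo_mem_nhdsLT zero_lt_one] with c hc
      rw [q.mem_ball_zero, map_smul_eq_mul, Real.norm_of_nonneg hc.1.le, hv]
      exact mul_lt_of_lt_one_left hr0 hc.2
  exact measure_mono_null (fun v hv => hsphere (not_not.1 hv))
    ((q.convex_ball 0 r).addHaar_frontier ν)

end Seminorm

lemma tendsto_of_forall_eventually_le_mul {α : Type*} {l : Filter α} {F G : α → ℝ} {a : ℝ}
    (hF : Tendsto F l (𝓝 a)) (hFG : ∀ c > 1, ∀ᶠ x in l, F x ≤ c * G x ∧ G x ≤ c * F x) :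
    Tendsto G l (𝓝 a) := by
  have hone : ∀ b : ℝ, Tendsto (fun c : ℝ => c * b) (𝓝[>] 1) (𝓝 b) := fun b => by
    simpa only [one_mul, id] using
      (tendsto_id.mono_left (nhdsWithin_le_nhds (a := (1 : ℝ)))).mul_const b
  refine tendsto_order.2 ⟨fun b hb => ?_, fun b hb => ?_⟩
  · obtain ⟨c, hc, hc1⟩ := (((hone b).eventually_lt_const hb).and self_mem_nhdsWithin).exists
    filter_upwards [hFG c hc1, hF.eventually_const_lt hc] with x hx hx'
    exact lt_of_mul_lt_mul_left (hx'.trans_le hx.1) (zero_le_one.trans (le_of_lt hc1))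
  · obtain ⟨c, hc, hc1⟩ := (((hone a).eventually_lt_const hb).and self_mem_nhdsWithin).exists
    filter_upwards [hFG c hc1, (hF.const_mul c).eventually_lt_const hc] with x hx hx'
    exact hx.2.trans_lt hx'

section BlowUp

variable {E : Type*} [NormedAddCommGroup E] [NormedSpace ℝ E] {H : Type*} [TopologicalSpace H]
  (I : ModelWithCorners ℝ E H) {M : Type*}

section Velocity

variable [TopologicalSpace M] [ChartedSpace H M]

/-- The point represented by `r • v` in the preferred chart at `ζ`, centred at `ζ`. -/
def blowUp (ζ : M) (r : ℝ) (v : E) : M :=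
  (extChartAt I ζ).symm (extChartAt I ζ ζ + r • v)

/-- The curve `x` tends to `ζ` with velocity `v` as its parameter decreases to `0`; the vector `v`
is read in the preferred chart at `ζ`. -/
def HasVelocity (ζ : M) (x : ℝ → M) (v : E) : Prop :=
  Tendsto x (𝓝[>] 0) (𝓝 ζ) ∧
    Tendsto (fun r : ℝ => r⁻¹ • (extChartAt I ζ (x r) - extChartAt I ζ ζ)) (𝓝[>] 0) (𝓝 v)

variable {I}

lemma tendsto_add_smul_nhdsGT_zero (a v : E) :
    Tendsto (fun r : ℝ => a + r • v) (𝓝[>] 0) (𝓝 a) := by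
  have : Continuous fun r : ℝ => a + r • v := by fun_prop
  simpa using (this.tendsto 0).mono_left nhdsWithin_le_nhds

lemma extChartAt_target_mem_nhds_of_isInteriorPoint {ζ : M} (hζ : I.IsInteriorPoint ζ) :
    (extChartAt I ζ).target ∈ 𝓝 (extChartAt I ζ ζ) := by
  have htarget := extChartAt_target_mem_nhdsWithin (I := I) ζ
  rwa [nhdsWithin_eq_nhds.2 (mem_interior_iff_mem_nhds.1 hζ)] at htarget

lemma hasVelocity_blowUp {ζ : M} (hζ : I.IsInteriorPoint ζ) (v : E) :
    HasVelocity I ζ (fun r => blowUp I ζ r v) v := by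
  have hlim := tendsto_add_smul_nhdsGT_zero (extChartAt I ζ ζ) v
  constructor
  · have hsymm := (continuousAt_extChartAt_symm (I := I) ζ).tendsto
    rw [extChartAt_to_inv] at hsymm
    exact hsymm.comp hlim
  · refine tendsto_const_nhds.congr' ?_
    filter_upwards [hlim.eventually (extChartAt_target_mem_nhds_of_isInteriorPoint hζ),
      self_mem_nhdsWithin] with r hr hr0
    rw [blowUp, (extChartAt I ζ).right_inv hr, add_sub_cancel_left, inv_smul_smul₀ (ne_of_gt hr0)]

lemma HasVelocity.map {ζ : M} {x : ℝ → M} {v : E} (hx : HasVelocity I ζ x v) {F : M → M}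
    {L : TangentSpace I ζ →L[ℝ] TangentSpace I (F ζ)} (hF : HasMFDerivAt I I F ζ L) :
    HasVelocity I (F ζ) (fun r => F (x r)) (L v) := by
  refine ⟨hF.1.tendsto.comp hx.1, ?_⟩
  have hsrc : ∀ᶠ r in 𝓝[>] (0 : ℝ), x r ∈ (extChartAt I ζ).source :=
    hx.1.eventually (extChartAt_source_mem_nhds (I := I) ζ)
  have hzero : Tendsto (fun r => extChartAt I ζ (x r) - extChartAt I ζ ζ) (𝓝[>] (0 : ℝ)) (𝓝 0) := by
    simpa only [sub_self, Function.comp_apply] using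
      ((continuousAt_extChartAt (I := I) ζ).tendsto.comp hx.1).sub_const (extChartAt I ζ ζ)
  have hderiv : HasFDerivWithinAt (writtenInExtChartAt I I ζ F) (show E →L[ℝ] E from L) (range I)
      (extChartAt I ζ ζ) := hF.2
  refine (hderiv.lim hzero (c := fun r => r⁻¹) ?_ hx.2).congr' ?_
  · filter_upwards [hsrc] with r hr
    rw [add_sub_cancel]
    exact extChartAt_target_subset_range ζ ((extChartAt I ζ).map_source hr)
  · filter_upwards [hsrc] with r hr
    simp only [writtenInExtChartAt, Function.comp_apply, add_sub_cancel, extChartAt_to_inv,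
      (extChartAt I ζ).left_inv hr]

lemma HasVelocity.iterate {ζ : M} {x : ℝ → M} {v : E} (hx : HasVelocity I ζ x v) {F : M → M}
    {L : E →L[ℝ] E} (hfix : Function.IsFixedPt F ζ) (hF : HasMFDerivAt I I F ζ L) (j : ℕ) :
    HasVelocity I ζ (fun r => F^[j] (x r)) (L^[j] v) := by
  induction j with
  | zero => exact hx
  | succ j ih =>
    simp only [Function.iterate_succ_apply']
    have hmap := ih.map hF
    simp only [hfix.eq] at hmap
    exact hmap

end Velocity

variable {I}

variable [MetricSpace M] [ChartedSpace H M] [IsManifold I 1 M]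
  [Bundle.RiemannianBundle (fun x : M => TangentSpace I x)]
  [IsContinuousRiemannianBundle E (fun x : M => TangentSpace I x)] [IsRiemannianManifold I M]

lemma HasVelocity.tendsto_dist_div {ζ : M} {x : ℝ → M} {v : E} (hx : HasVelocity I ζ x v) :
    Tendsto (fun r => dist (x r) ζ / r) (𝓝[>] 0) (𝓝 (chartNorm I ζ v)) := by
  refine tendsto_of_forall_eventually_le_mul
    (((continuous_chartNorm I ζ).tendsto v).comp hx.2) fun c hc => ?_
  filter_upwards [hx.1.eventually (eventually_chartNorm_le_dist I ζ hc),
    hx.1.eventually (eventually_dist_le_chartNorm I ζ hc), self_mem_nhdsWithin] with r hle hge hr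
  have hr : 0 < r := hr
  rw [dist_comm] at hle hge
  simp only [Function.comp_apply, map_smul_eq_mul, Real.norm_of_nonneg (inv_pos.2 hr).le]
  constructor
  · rw [inv_mul_le_iff₀ hr, mul_div_assoc', mul_div_cancel₀ _ hr.ne']
    exact hle
  · rw [div_le_iff₀ hr, mul_assoc, mul_right_comm, inv_mul_cancel₀ hr.ne', one_mul]
    exact hge

lemma HasVelocity.eventually_mem_ball_iff {ζ : M} {x : ℝ → M} {v : E} (hx : HasVelocity I ζ x v)
    (hv : chartNorm I ζ v ≠ 1) :
    ∀ᶠ r in 𝓝[>] (0 : ℝ), x r ∈ Metric.ball ζ r ↔ v ∈ (chartNorm I ζ).ball 0 1 := by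
  simp only [Seminorm.mem_ball_zero, Metric.mem_ball]
  rcases hv.lt_or_gt with hlt | hgt
  · filter_upwards [hx.tendsto_dist_div.eventually_lt_const hlt, self_mem_nhdsWithin] with r hr hr0
    simpa only [hlt, iff_true] using (div_lt_one hr0).1 hr
  · filter_upwards [hx.tendsto_dist_div.eventually_const_lt hgt, self_mem_nhdsWithin] with r hr hr0
    simpa only [hgt.not_gt, iff_false, not_lt] using ((one_lt_div hr0).1 hr).le

end BlowUp

lemma eventually_forall_subset_ball {X : Type*} [PseudoMetricSpace X] {x : X} {P : Set X → Prop}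
    (hP : ∀ᶠ A in (𝓝 x).smallSets, P A) :
    ∀ᶠ r in 𝓝[>] (0 : ℝ), ∀ A ⊆ Metric.ball x r, P A := by
  obtain ⟨t, ht, hts⟩ := eventually_smallSets.1 hP
  obtain ⟨ε, ε_pos, hε⟩ := Metric.mem_nhds_iff.1 ht
  filter_upwards [Ioo_mem_nhdsGT ε_pos] with r hr A hA
  exact hts A ((hA.trans (Metric.ball_subset_ball hr.2.le)).trans hε)

lemma addHaar_real_preimage_add_smul {E : Type*} [NormedAddCommGroup E] [NormedSpace ℝ E]
    [MeasurableSpace E] [BorelSpace E] [FiniteDimensional ℝ E] (ν : Measure E)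
    [ν.IsAddHaarMeasure] (a : E) {r : ℝ} (hr : 0 < r) (S : Set E) :
    ν.real ((fun v => a + r • v) ⁻¹' S) = ν.real S / r ^ Module.finrank ℝ E := by
  have hpre : (fun v : E => a + r • v) ⁻¹' S = (r • ·) ⁻¹' ((a + ·) ⁻¹' S) := rfl
  rw [hpre, measureReal_def, Measure.addHaar_preimage_smul ν hr.ne', measure_preimage_add,
    ENNReal.toReal_mul, ENNReal.toReal_ofReal (abs_nonneg _), abs_of_pos (by positivity),
    inv_mul_eq_div, measureReal_def]

section Volume

variable {d : ℕ} {H : Type*} [TopologicalSpace H]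
  {I : ModelWithCorners ℝ (EuclideanSpace ℝ (Fin d)) H} {M : Type*}

section ChartDensity

variable [TopologicalSpace M] [ChartedSpace H M] [MeasurableSpace M] [BorelSpace M]
  {Leb : Measure M}

lemma measurableSet_extChartAt_target_inter_preimage (x : M) {A : Set M} (hA : MeasurableSet A) :
    MeasurableSet ((extChartAt I x).target ∩ (extChartAt I x).symm ⁻¹' A) := by
  have htarget : MeasurableSet (extChartAt I x).target := by
    rw [extChartAt_target]
    exact ((chartAt H x).open_target.preimage I.continuous_symm).measurableSet.inter
      I.isClosed_range.measurableSet
  rw [← Subtype.image_preimage_coe]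
  exact htarget.subtype_image
    ((continuousOn_iff_continuous_domRestrict.1 (continuousOn_extChartAt_symm x)).measurable hA)

lemma IsVolumeMeasure.exists_eventually_le_mul (hLeb : IsVolumeMeasure I Leb) (x : M) :
    ∃ h₀ > 0, ∀ c > 1, ∀ᶠ A in (𝓝 x).smallSets, MeasurableSet A →
      Leb A ≤ ENNReal.ofReal (c * h₀) * volume (extChartAt I x '' A) ∧
      ENNReal.ofReal h₀ * volume (extChartAt I x '' A) ≤ ENNReal.ofReal c * Leb A := by
  obtain ⟨h, hcont, hpos, hint⟩ := hLeb x
  have h₀_pos := hpos _ (mem_extChartAt_target x)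
  refine ⟨h (extChartAt I x x), h₀_pos, fun c hc => ?_⟩
  have hlim : ContinuousAt (h ∘ extChartAt I x) x :=
    (hcont.comp (continuousOn_extChartAt x) (extChartAt I x).mapsTo).continuousAt
      (extChartAt_source_mem_nhds x)
  have hnear : ∀ᶠ y in 𝓝 x, h (extChartAt I x y) ≤ c * h (extChartAt I x x) ∧
      h (extChartAt I x x) ≤ c * h (extChartAt I x y) :=
    ((hlim.eventually_lt_const (lt_mul_of_one_lt_left h₀_pos hc)).and
      ((hlim.tendsto.const_mul c).eventually_const_lt (lt_mul_of_one_lt_left h₀_pos hc))).mono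
      fun y hy => ⟨hy.1.le, hy.2.le⟩
  filter_upwards [eventually_smallSets_forall.2 hnear,
    eventually_smallSets_subset.2 (extChartAt_source_mem_nhds (I := I) x)] with A hle hsrc hA
  have himage : MeasurableSet (extChartAt I x '' A) :=
    (extChartAt I x).image_eq_target_inter_inv_preimage hsrc ▸
      measurableSet_extChartAt_target_inter_preimage x hA
  rw [hint A hsrc hA, ← setLIntegral_const, ← setLIntegral_const,
    ← lintegral_const_mul' _ _ ENNReal.ofReal_ne_top]
  constructor
  · refine setLIntegral_mono' himage (forall_mem_image.2 fun y hy => ?_)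
    exact ENNReal.ofReal_le_ofReal (hle y hy).1
  · refine setLIntegral_mono' himage (forall_mem_image.2 fun y hy => ?_)
    rw [← ENNReal.ofReal_mul (zero_le_one.trans (le_of_lt hc))]
    exact ENNReal.ofReal_le_ofReal (hle y hy).2

lemma IsVolumeMeasure.isLocallyFiniteMeasure (hLeb : IsVolumeMeasure I Leb) :
    IsLocallyFiniteMeasure Leb := by
  refine ⟨fun x => ?_⟩
  obtain ⟨h₀, -, hle⟩ := hLeb.exists_eventually_le_mul x
  obtain ⟨V, hV, hle⟩ := eventually_smallSets.1 (hle 2 one_lt_two)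
  obtain ⟨U, hU, U_open, hxU⟩ := mem_nhds_iff.1 (inter_mem hV
    ((continuousAt_extChartAt (I := I) x).preimage_mem_nhds (Metric.ball_mem_nhds _ one_pos)))
  refine ⟨U, U_open.mem_nhds hxU,
    (hle U (hU.trans inter_subset_left) U_open.measurableSet).1.trans_lt ?_⟩
  exact ENNReal.mul_lt_top ENNReal.ofReal_lt_top ((measure_mono (image_subset_iff.2
    (hU.trans inter_subset_right))).trans_lt measure_ball_lt_top)

end ChartDensity

section Chart

variable [MetricSpace M] [ChartedSpace H M] [IsManifold I 1 M]
  [Bundle.RiemannianBundle (fun x : M => TangentSpace I x)]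
  [IsContinuousRiemannianBundle (EuclideanSpace ℝ (Fin d)) (fun x : M => TangentSpace I x)]
  [IsRiemannianManifold I M]

lemma eventually_preimage_extChartAt_image_ball_subset (ζ : M) :
    ∀ᶠ r in 𝓝[>] (0 : ℝ), (fun v => extChartAt I ζ ζ + r • v) ⁻¹'
      (extChartAt I ζ '' Metric.ball ζ r) ⊆ (chartNorm I ζ).ball 0 2 := by
  obtain ⟨ε, ε_pos, hε⟩ := Metric.eventually_nhds_iff.1
    (eventually_chartNorm_le_dist I ζ one_lt_two)
  filter_upwards [Ioo_mem_nhdsGT ε_pos] with r hr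
  rintro v ⟨y, hy, hyv⟩
  have hy' := hε (lt_trans hy hr.2)
  rw [hyv, add_sub_cancel_left, map_smul_eq_mul, Real.norm_of_nonneg hr.1.le, dist_comm] at hy'
  rw [Seminorm.mem_ball_zero]
  exact lt_of_mul_lt_mul_left
    (hy'.trans_lt ((mul_lt_mul_of_pos_left hy two_pos).trans_eq (mul_comm _ _))) hr.1.le

end Chart

section TangentDensity

variable [MetricSpace M] [MeasurableSpace M]

/-- The measurable sets `A r ⊆ ball ζ r`, rescaled by `r⁻¹` in the preferred chart at `ζ`, converge
almost everywhere to `A₀` as `r` decreases to `0`. -/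
structure HasBlowUp (I : ModelWithCorners ℝ (EuclideanSpace ℝ (Fin d)) H) [ChartedSpace H M]
    (ζ : M) (A : ℝ → Set M) (A₀ : Set (EuclideanSpace ℝ (Fin d))) : Prop where
  measurableSet : ∀ r, MeasurableSet (A r)
  subset_ball : ∀ r, A r ⊆ Metric.ball ζ r
  measurableSet_limit : MeasurableSet A₀
  eventually_mem_iff : ∀ᵐ v, ∀ᶠ r in 𝓝[>] (0 : ℝ), blowUp I ζ r v ∈ A r ↔ v ∈ A₀

/-- To first order at `ζ`, the measure `m` is `c` times the Lebesgue measure of the preferred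
chart. -/
def HasTangentDensity (I : ModelWithCorners ℝ (EuclideanSpace ℝ (Fin d)) H) [ChartedSpace H M]
    (m : Measure M) (ζ : M) (c : ℝ) : Prop :=
  ∀ (A : ℝ → Set M) (A₀ : Set (EuclideanSpace ℝ (Fin d))), HasBlowUp I ζ A A₀ →
    Tendsto (fun r => m.real (A r) / r ^ d) (𝓝[>] 0) (𝓝 (c * volume.real A₀))

variable [ChartedSpace H M] [IsManifold I 1 M]
  [Bundle.RiemannianBundle (fun x : M => TangentSpace I x)]
  [IsContinuousRiemannianBundle (EuclideanSpace ℝ (Fin d)) (fun x : M => TangentSpace I x)]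
  [IsRiemannianManifold I M]

variable [BorelSpace M] {ζ : M} {A : ℝ → Set M} {A₀ : Set (EuclideanSpace ℝ (Fin d))}

lemma HasBlowUp.tendsto_volume_image (hA : HasBlowUp I ζ A A₀) (hζ : I.IsInteriorPoint ζ) :
    Tendsto (fun r => volume.real (extChartAt I ζ '' A r) / r ^ d) (𝓝[>] 0)
      (𝓝 (volume.real A₀)) := by
  let S : ℝ → Set (EuclideanSpace ℝ (Fin d)) := fun r => (fun v => extChartAt I ζ ζ + r • v) ⁻¹'
    ((extChartAt I ζ).target ∩ (extChartAt I ζ).symm ⁻¹' A r)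
  have hS : ∀ᶠ r in 𝓝[>] (0 : ℝ),
      S r = (fun v => extChartAt I ζ ζ + r • v) ⁻¹' (extChartAt I ζ '' A r) := by
    filter_upwards [eventually_forall_subset_ball
      (eventually_smallSets_subset.2 (extChartAt_source_mem_nhds (I := I) ζ))] with r hr
    rw [(extChartAt I ζ).image_eq_target_inter_inv_preimage (hr _ (hA.subset_ball r))]
  obtain ⟨C, hC, hnorm⟩ := exists_norm_le_chartNorm I ζ
  have hfin : volume ((chartNorm I ζ).ball 0 2) ≠ ⊤ :=
    (addHaar_seminorm_ball_lt_top volume hC hnorm 2).ne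
  have hsub : ∀ᶠ r in 𝓝[>] (0 : ℝ), S r ⊆ (chartNorm I ζ).ball 0 2 := by
    filter_upwards [hS, eventually_preimage_extChartAt_image_ball_subset (I := I) ζ] with r hr hr'
    exact hr ▸ (preimage_mono (image_mono (hA.subset_ball r))).trans hr'
  have hlim : Tendsto (fun r => volume (S r)) (𝓝[>] 0) (𝓝 (volume A₀)) := by
    refine tendsto_measure_of_ae_tendsto_indicator _ hA.measurableSet_limit
      (fun r => (measurableSet_extChartAt_target_inter_preimage ζ (hA.measurableSet r)).preimage
        (by fun_prop))
      (isOpen_seminorm_ball (continuous_chartNorm I ζ) 2).measurableSet hfin hsub ?_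
    filter_upwards [hA.eventually_mem_iff] with v hv
    filter_upwards [hv, (tendsto_add_smul_nhdsGT_zero _ v).eventually
      (extChartAt_target_mem_nhds_of_isInteriorPoint hζ)] with r hr hr_target
    exact Iff.trans ⟨And.right, And.intro hr_target⟩ hr
  have hA₀ : volume A₀ ≠ ⊤ := ne_top_of_le_ne_top hfin
    (le_of_tendsto hlim (hsub.mono fun r hr => measure_mono hr))
  refine ((ENNReal.tendsto_toReal hA₀).comp hlim).congr' ?_
  filter_upwards [hS, self_mem_nhdsWithin] with r hr hr_pos
  rw [Function.comp_apply, ← measureReal_def, hr, addHaar_real_preimage_add_smul volume _ hr_pos,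
    finrank_euclideanSpace_fin]

variable {Leb : Measure M}

lemma IsVolumeMeasure.exists_hasTangentDensity (hLeb : IsVolumeMeasure I Leb)
    (hζ : I.IsInteriorPoint ζ) : ∃ c > 0, HasTangentDensity I Leb ζ c := by
  have := hLeb.isLocallyFiniteMeasure
  obtain ⟨h₀, h₀_pos, hle⟩ := hLeb.exists_eventually_le_mul ζ
  obtain ⟨U, hU, hUfin⟩ := Leb.finiteAt_nhds ζ
  refine ⟨h₀, h₀_pos, fun A A₀ hA => tendsto_of_forall_eventually_le_mul
    ((hA.tendsto_volume_image hζ).const_mul h₀) fun c hc => ?_⟩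
  filter_upwards [eventually_forall_subset_ball (hle c hc),
    eventually_forall_subset_ball (eventually_smallSets_subset.2 hU), self_mem_nhdsWithin]
    with r hr hr_fin hr_pos
  have hpow : 0 < r ^ d := pow_pos hr_pos d
  have hc0 : 0 < c := zero_lt_one.trans hc
  obtain ⟨hupper, hlower⟩ := hr _ (hA.subset_ball r) (hA.measurableSet r)
  have hfin : Leb (A r) ≠ ⊤ :=
    ne_top_of_le_ne_top hUfin.ne (measure_mono (hr_fin _ (hA.subset_ball r)))
  have hfin' : volume (extChartAt I ζ '' A r) ≠ ⊤ := fun h => by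
    rw [h, ENNReal.mul_top (ENNReal.ofReal_pos.2 h₀_pos).ne'] at hlower
    exact ENNReal.mul_ne_top ENNReal.ofReal_ne_top hfin (top_le_iff.1 hlower)
  have hlower := ENNReal.toReal_mono (by finiteness) hlower
  have hupper := ENNReal.toReal_mono (by finiteness) hupper
  rw [ENNReal.toReal_mul, ENNReal.toReal_mul, ENNReal.toReal_ofReal h₀_pos.le,
    ENNReal.toReal_ofReal hc0.le] at hlower
  rw [ENNReal.toReal_mul, ENNReal.toReal_ofReal (by positivity), mul_assoc] at hupper
  simp only [← mul_div_assoc]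
  exact ⟨div_le_div_of_nonneg_right hlower hpow.le, div_le_div_of_nonneg_right hupper hpow.le⟩

end TangentDensity

end Volume

section LebesguePoint

section Deviation

variable {M : Type*} [MeasurableSpace M] {μ Leb : Measure M} [SigmaFinite μ] [SigmaFinite Leb]

lemma measure_le_mul_add_lintegral_rnDeriv_sub (hμ : μ ≪ Leb) {ρ : ℝ} (hρ : 0 ≤ ρ) (A : Set M) :
    μ A ≤ ENNReal.ofReal ρ * Leb A + ∫⁻ x in A, ‖(μ.rnDeriv Leb x).toReal - ρ‖ₑ ∂Leb := by
  rw [← Measure.setLIntegral_rnDeriv hμ, ← setLIntegral_const,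
    ← lintegral_add_left measurable_const]
  refine lintegral_mono_ae ?_
  filter_upwards [ae_restrict_of_ae (Measure.rnDeriv_lt_top μ Leb)] with x hx
  rw [← ofReal_norm, Real.norm_eq_abs, ← ENNReal.ofReal_add hρ (abs_nonneg _)]
  refine (ENNReal.le_ofReal_iff_toReal_le hx.ne (by positivity)).2 ?_
  linarith [le_abs_self ((μ.rnDeriv Leb x).toReal - ρ)]

lemma mul_le_measure_add_lintegral_rnDeriv_sub (hμ : μ ≪ Leb) (ρ : ℝ) (A : Set M) :
    ENNReal.ofReal ρ * Leb A ≤ μ A + ∫⁻ x in A, ‖(μ.rnDeriv Leb x).toReal - ρ‖ₑ ∂Leb := by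
  rw [← Measure.setLIntegral_rnDeriv hμ, ← setLIntegral_const,
    ← lintegral_add_left (Measure.measurable_rnDeriv μ Leb)]
  refine lintegral_mono_ae ?_
  filter_upwards [ae_restrict_of_ae (Measure.rnDeriv_lt_top μ Leb)] with x hx
  rw [← ofReal_norm, Real.norm_eq_abs]
  nth_rewrite 1 [← ENNReal.ofReal_toReal hx.ne]
  rw [← ENNReal.ofReal_add ENNReal.toReal_nonneg (abs_nonneg _)]
  refine ENNReal.ofReal_le_ofReal ?_
  linarith [neg_abs_le ((μ.rnDeriv Leb x).toReal - ρ)]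

lemma abs_measureReal_sub_mul_le (hμ : μ ≪ Leb) {ρ : ℝ} (hρ : 0 ≤ ρ) {A B : Set M} (hAB : A ⊆ B)
    (hB : Leb B ≠ ⊤) (hdev : ∫⁻ x in B, ‖(μ.rnDeriv Leb x).toReal - ρ‖ₑ ∂Leb ≠ ⊤) :
    |μ.real A - ρ * Leb.real A| ≤
      (∫⁻ x in B, ‖(μ.rnDeriv Leb x).toReal - ρ‖ₑ ∂Leb).toReal := by
  have hA : Leb A ≠ ⊤ := ne_top_of_le_ne_top hB (measure_mono hAB)
  have hupper := (measure_le_mul_add_lintegral_rnDeriv_sub hμ hρ A).trans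
    (add_le_add_right (lintegral_mono_set hAB) _)
  have hlower := (mul_le_measure_add_lintegral_rnDeriv_sub hμ ρ A).trans
    (add_le_add_right (lintegral_mono_set hAB) _)
  have hμA : μ A ≠ ⊤ := ne_top_of_le_ne_top (by finiteness) hupper
  have hupper := ENNReal.toReal_mono (by finiteness) hupper
  have hlower := ENNReal.toReal_mono (by finiteness) hlower
  rw [ENNReal.toReal_add (by finiteness) hdev, ENNReal.toReal_mul,
    ENNReal.toReal_ofReal hρ] at hupper
  rw [ENNReal.toReal_add (by finiteness) hdev, ENNReal.toReal_mul,
    ENNReal.toReal_ofReal hρ] at hlower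
  rw [measureReal_def, measureReal_def, abs_le]
  constructor <;> linarith

end Deviation

variable {d : ℕ} {H : Type*} [TopologicalSpace H]
  {I : ModelWithCorners ℝ (EuclideanSpace ℝ (Fin d)) H}
  {M : Type*} [MetricSpace M] [ChartedSpace H M] [IsManifold I 1 M]
  [Bundle.RiemannianBundle (fun x : M => TangentSpace I x)]

variable (I) in
lemma volume_real_chartNorm_ball_pos (ζ : M) :
    0 < volume.real ((chartNorm I ζ).ball 0 1) := by
  obtain ⟨C, hC, hnorm⟩ := exists_norm_le_chartNorm I ζ
  exact ENNReal.toReal_pos (addHaar_seminorm_ball_pos volume (continuous_chartNorm I ζ) one_pos).ne'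
    (addHaar_seminorm_ball_lt_top volume hC hnorm 1).ne

variable [IsContinuousRiemannianBundle (EuclideanSpace ℝ (Fin d)) (fun x : M => TangentSpace I x)]
  [IsRiemannianManifold I M] [MeasurableSpace M] [BorelSpace M] {ζ : M} {c : ℝ}

lemma hasBlowUp_ball (hζ : I.IsInteriorPoint ζ) :
    HasBlowUp I ζ (Metric.ball ζ) ((chartNorm I ζ).ball 0 1) where
  measurableSet _ := Metric.isOpen_ball.measurableSet
  subset_ball _ := subset_rfl
  measurableSet_limit := (isOpen_seminorm_ball (continuous_chartNorm I ζ) 1).measurableSet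
  eventually_mem_iff := (ae_seminorm_ne volume (continuous_chartNorm I ζ) one_ne_zero).mono
    fun v hv => (hasVelocity_blowUp hζ v).eventually_mem_ball_iff hv

section Density

variable {m : Measure M}

lemma HasTangentDensity.eventually_measureReal_ball_pos (hm : HasTangentDensity I m ζ c)
    (hc : 0 < c) (hζ : I.IsInteriorPoint ζ) :
    ∀ᶠ r in 𝓝[>] (0 : ℝ), 0 < m.real (Metric.ball ζ r) := by
  filter_upwards [(hm _ _ (hasBlowUp_ball hζ)).eventually_const_lt
    (mul_pos hc (volume_real_chartNorm_ball_pos I ζ)), self_mem_nhdsWithin] with r hr hr_pos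
  exact (div_pos_iff_of_pos_right (pow_pos hr_pos d)).1 hr

lemma HasTangentDensity.measureReal_ball_pos [IsFiniteMeasure m] (hm : HasTangentDensity I m ζ c)
    (hc : 0 < c) (hζ : I.IsInteriorPoint ζ) {r : ℝ} (hr : 0 < r) :
    0 < m.real (Metric.ball ζ r) := by
  obtain ⟨s, hs, hsr⟩ := ((hm.eventually_measureReal_ball_pos hc hζ).and
    (Ioo_mem_nhdsGT hr)).exists
  exact hs.trans_le (measureReal_mono (Metric.ball_subset_ball hsr.2.le))

lemma HasTangentDensity.tendsto_measureReal_ball (hm : HasTangentDensity I m ζ c)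
    (hζ : I.IsInteriorPoint ζ) (hd : 0 < d) :
    Tendsto (fun r => m.real (Metric.ball ζ r)) (𝓝[>] 0) (𝓝 0) := by
  have hpow : Tendsto (fun r : ℝ => r ^ d) (𝓝[>] 0) (𝓝 0) := by
    simpa only [zero_pow hd.ne'] using
      ((continuous_pow d).tendsto (0 : ℝ)).mono_left nhdsWithin_le_nhds
  have hlim := (hm _ _ (hasBlowUp_ball hζ)).mul hpow
  rw [mul_zero] at hlim
  refine hlim.congr' ?_
  filter_upwards [self_mem_nhdsWithin] with r hr
  exact div_mul_cancel₀ _ (pow_pos hr d).ne'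

lemma HasTangentDensity.tendsto_measureReal_div_ball (hm : HasTangentDensity I m ζ c)
    (hc : 0 < c) (hζ : I.IsInteriorPoint ζ) {A : ℝ → Set M} {A₀ : Set (EuclideanSpace ℝ (Fin d))}
    (hA : HasBlowUp I ζ A A₀) :
    Tendsto (fun r => m.real (A r) / m.real (Metric.ball ζ r)) (𝓝[>] 0)
      (𝓝 (volume.real A₀ / volume.real ((chartNorm I ζ).ball 0 1))) := by
  have hlim := (hm A A₀ hA).div (hm _ _ (hasBlowUp_ball hζ))
    (mul_pos hc (volume_real_chartNorm_ball_pos I ζ)).ne'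
  rw [mul_div_mul_left _ _ hc.ne'] at hlim
  refine hlim.congr' ?_
  filter_upwards [self_mem_nhdsWithin] with r hr
  exact div_div_div_cancel_right₀ (pow_pos hr d).ne' _ _

end Density

lemma IsLebesguePoint.hasTangentDensity {μ Leb : Measure M} [SigmaFinite μ] [SigmaFinite Leb]
    {ρ : ℝ} (hdens : IsLebesguePoint μ Leb ζ ρ) (hμ : μ ≪ Leb) (hρ : 0 ≤ ρ)
    (hLeb : HasTangentDensity I Leb ζ c) (hc : 0 < c) (hζ : I.IsInteriorPoint ζ) :
    HasTangentDensity I μ ζ (ρ * c) := by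
  intro A A₀ hA
  let e : ℝ → ℝ≥0∞ := fun r =>
    ∫⁻ x in Metric.ball ζ r, ‖(μ.rnDeriv Leb x).toReal - ρ‖ₑ ∂Leb
  have he : Tendsto (fun r => (e r / Leb (Metric.ball ζ r)).toReal *
      (Leb.real (Metric.ball ζ r) / r ^ d)) (𝓝[>] 0) (𝓝 0) := by
    have hmean := (ENNReal.tendsto_toReal ENNReal.zero_ne_top).comp hdens
    simpa only [ENNReal.toReal_zero, zero_mul, Function.comp_apply] using
      hmean.mul (hLeb _ _ (hasBlowUp_ball hζ))
  have hdiff : Tendsto (fun r => μ.real (A r) / r ^ d - ρ * (Leb.real (A r) / r ^ d))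
      (𝓝[>] 0) (𝓝 0) := by
    refine squeeze_zero_norm' ?_ he
    filter_upwards [hLeb.eventually_measureReal_ball_pos hc hζ,
      hdens.eventually_lt_const ENNReal.zero_lt_top, self_mem_nhdsWithin] with r hr hr_dev hr_pos
    have hpow : 0 < r ^ d := pow_pos hr_pos d
    obtain ⟨hball_pos, hball_lt⟩ := ENNReal.toReal_pos_iff.1 hr
    have hdev : e r ≠ ⊤ := fun h => by
      simp only [e] at h
      rw [h, ENNReal.top_div_of_ne_top hball_lt.ne] at hr_dev
      exact lt_irrefl _ hr_dev
    have habs := abs_measureReal_sub_mul_le hμ hρ (hA.subset_ball r) hball_lt.ne hdev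
    rw [Real.norm_eq_abs, ← mul_div_assoc, ← mul_div_assoc, ← sub_div, abs_div, abs_of_pos hpow,
      measureReal_def Leb (Metric.ball ζ r), ← ENNReal.toReal_mul,
      ENNReal.div_mul_cancel hball_pos.ne' hball_lt.ne]
    exact div_le_div_of_nonneg_right habs hpow.le
  simpa only [sub_add_cancel, zero_add, mul_assoc] using hdiff.add ((hLeb A A₀ hA).const_mul ρ)

end LebesguePoint

/-- The points of `B` which `F` maps out of `B`. -/
def exitSet {α : Type*} (F : α → α) (B : Set α) : Set α := B \ F ⁻¹' B

section Exit

variable {α : Type*} {F : α → α} {B : Set α}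

lemma exists_lt_iterate_mem_exitSet {x : α} (hx : x ∈ B) {m : ℕ} (hm : F^[m] x ∉ B) :
    ∃ k < m, F^[k] x ∈ exitSet F B := by
  induction m with
  | zero => exact absurd hx hm
  | succ m ih =>
    by_cases h : F^[m] x ∈ B
    · exact ⟨m, m.lt_succ_self, h, by rwa [Function.iterate_succ_apply'] at hm⟩
    · obtain ⟨k, hk, hmem⟩ := ih h
      exact ⟨k, hk.trans m.lt_succ_self, hmem⟩

lemma measurableSet_exitSet [MeasurableSpace α] (hF : Measurable F) (hB : MeasurableSet B) :
    MeasurableSet (exitSet F B) :=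
  hB.diff (hF hB)

lemma measureReal_exitSet [MeasurableSpace α] {ν : Measure α} (hF : Measurable F)
    (hB : MeasurableSet B) (hfin : ν B ≠ ⊤) :
    ν.real (exitSet F B) = ν.real B - ν.real (B ∩ F ⁻¹' B) :=
  eq_sub_of_add_eq' (measureReal_inter_add_sdiff (hF hB) hfin)

end Exit

section Expansion

variable {E : Type*} [NormedAddCommGroup E] [NormedSpace ℝ E] [FiniteDimensional ℝ E]
  [MeasurableSpace E] [BorelSpace E] (ν : Measure E) [ν.IsAddHaarMeasure] (L : E ≃L[ℝ] E)

lemma addHaar_preimage_iterate (j : ℕ) (s : Set E) :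
    ν (L^[j] ⁻¹' s) = ENNReal.ofReal |(L.symm : E →L[ℝ] E).det| ^ j * ν s := by
  induction j generalizing s with
  | zero => simp
  | succ j ih =>
    rw [Function.iterate_succ', preimage_comp, ih, Measure.addHaar_preimage_continuousLinearEquiv,
      ← mul_assoc, pow_succ]
    rfl

variable {L} {U : Set E}

lemma addHaar_forall_iterate_mem_eq_zero (hdet : |(L.symm : E →L[ℝ] E).det| < 1)
    (hUfin : ν U ≠ ⊤) : ν {v | ∀ j : ℕ, L^[j] v ∈ U} = 0 := by
  have hlim := ENNReal.Tendsto.mul_const (ENNReal.tendsto_pow_atTop_nhds_zero_of_lt_one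
    (ENNReal.ofReal_lt_one.2 hdet)) (Or.inr hUfin)
  rw [zero_mul] at hlim
  refine le_antisymm (ge_of_tendsto' hlim fun j => ?_) zero_le
  rw [← addHaar_preimage_iterate]
  exact measure_mono fun v hv => hv j

/-- A point outside `U` which `L` maps into `U` lies on an orbit which enters and leaves `U` at
least twice: its backward orbit tends to `0`, and almost no forward orbit stays in `U`. -/
lemma addHaar_preimage_sdiff_eq_zero (hdet : |(L.symm : E →L[ℝ] E).det| < 1)
    (hcontr : ∀ v, Tendsto (fun k : ℕ => L.symm^[k] v) atTop (𝓝 0)) (hU : U ∈ 𝓝 0)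
    (hUfin : ν U ≠ ⊤) (hret : ∀ j ≥ 1, ν (exitSet L U ∩ L^[j] ⁻¹' exitSet L U) = 0) :
    ν (L ⁻¹' U \ U) = 0 := by
  have hcover : L ⁻¹' U \ U ⊆ (L^[1] ⁻¹' {v | ∀ j : ℕ, L^[j] v ∈ U}) ∪
      ⋃ i : ℕ, ⋃ j ∈ Ici 1, L.symm^[i] ⁻¹' (exitSet L U ∩ L^[j] ⁻¹' exitSet L U) := by
    rintro y ⟨hLy, hy⟩
    by_cases htrapped : ∀ j : ℕ, L^[j] (L y) ∈ U
    · exact Or.inl htrapped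
    obtain ⟨i, hi⟩ := not_forall.1 htrapped
    obtain ⟨k, -, hk⟩ := exists_lt_iterate_mem_exitSet (x := L y) hLy hi
    obtain ⟨m, hm⟩ := ((hcontr y).eventually hU).exists
    have hinv : ∀ n, L^[n] (L.symm^[n] y) = y := fun n => L.toEquiv.right_inv.iterate n y
    obtain ⟨l, hl, hexit⟩ := exists_lt_iterate_mem_exitSet (F := L) hm (by rwa [hinv m])
    obtain ⟨n, rfl⟩ := Nat.exists_eq_add_of_lt hl
    have hcancel : L^[l] (L.symm^[l + n + 1] y) = L.symm^[n + 1] y := by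
      rw [add_assoc, Function.iterate_add_apply]
      exact L.toEquiv.right_inv.iterate l _
    rw [hcancel] at hexit
    refine Or.inr (mem_iUnion.2 ⟨n + 1, mem_iUnion₂.2 ⟨k + 1 + (n + 1), ?_, hexit, ?_⟩⟩)
    · exact mem_Ici.2 (by omega)
    · rw [mem_preimage, Function.iterate_add_apply, hinv]
      exact hk
  refine measure_mono_null hcover (measure_union_null ?_ (measure_iUnion_null fun i =>
    (measure_biUnion_null_iff (to_countable _)).2 fun j hj => ?_))
  · rw [addHaar_preimage_iterate, addHaar_forall_iterate_mem_eq_zero ν hdet hUfin, mul_zero]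
  · rw [addHaar_preimage_iterate ν L.symm, hret j hj, mul_zero]

lemma addHaar_real_preimage :
    ν.real (L ⁻¹' U) = |(L.symm : E →L[ℝ] E).det| * ν.real U := by
  have h := addHaar_preimage_iterate ν L 1 U
  rw [Function.iterate_one, pow_one] at h
  rw [measureReal_def, h, ENNReal.toReal_mul, ENNReal.toReal_ofReal (abs_nonneg _),
    measureReal_def]

lemma le_addHaar_real_exitSet (hU : MeasurableSet U) (hUfin : ν U ≠ ⊤) :
    (1 - |(L.symm : E →L[ℝ] E).det|) * ν.real U ≤ ν.real (exitSet L U) := by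
  have hfin : ν (L ⁻¹' U) ≠ ⊤ := by
    have h := addHaar_preimage_iterate ν L 1 U
    rw [Function.iterate_one, pow_one] at h
    rw [h]
    finiteness
  rw [measureReal_exitSet L.continuous.measurable hU hUfin, sub_mul, one_mul,
    ← addHaar_real_preimage]
  exact sub_le_sub_left (measureReal_mono inter_subset_right hfin) _

lemma addHaar_real_exitSet_eq (hdet : |(L.symm : E →L[ℝ] E).det| < 1)
    (hcontr : ∀ v, Tendsto (fun k : ℕ => L.symm^[k] v) atTop (𝓝 0)) (hU : U ∈ 𝓝 0)
    (hUm : MeasurableSet U) (hUfin : ν U ≠ ⊤)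
    (hret : ∀ j ≥ 1, ν (exitSet L U ∩ L^[j] ⁻¹' exitSet L U) = 0) :
    ν.real (exitSet L U) = (1 - |(L.symm : E →L[ℝ] E).det|) * ν.real U := by
  have hae : (U ∩ L ⁻¹' U : Set E) =ᵐ[ν] L ⁻¹' U := by
    rw [inter_comm, ← sdiff_sdiff_right_self]
    exact sdiff_null_ae_eq_self (addHaar_preimage_sdiff_eq_zero ν hdet hcontr hU hUfin hret)
  rw [measureReal_exitSet L.continuous.measurable hUm hUfin, measureReal_congr hae,
    addHaar_real_preimage, sub_mul, one_mul]

end Expansion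

section FixedPoint

variable {d : ℕ} {H : Type*} [TopologicalSpace H]
  {I : ModelWithCorners ℝ (EuclideanSpace ℝ (Fin d)) H}
  {M : Type*} [MetricSpace M] [ChartedSpace H M] [IsManifold I 1 M]
  [Bundle.RiemannianBundle (fun x : M => TangentSpace I x)]
  [IsContinuousRiemannianBundle (EuclideanSpace ℝ (Fin d)) (fun x : M => TangentSpace I x)]
  [IsRiemannianManifold I M] {ζ : M} {F : M → M}
  {L : EuclideanSpace ℝ (Fin d) ≃L[ℝ] EuclideanSpace ℝ (Fin d)}

lemma ae_eventually_iterate_mem_ball_iff (hζ : I.IsInteriorPoint ζ)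
    (hfix : Function.IsFixedPt F ζ)
    (hF : HasMFDerivAt I I F ζ (L : EuclideanSpace ℝ (Fin d) →L[ℝ] EuclideanSpace ℝ (Fin d))) :
    ∀ᵐ v, ∀ j : ℕ, ∀ᶠ r in 𝓝[>] (0 : ℝ),
      F^[j] (blowUp I ζ r v) ∈ Metric.ball ζ r ↔ L^[j] v ∈ (chartNorm I ζ).ball 0 1 := by
  refine ae_all_iff.2 fun j => ?_
  have hne : ∀ᵐ v, chartNorm I ζ (L^[j] v) ≠ 1 := by
    change volume (L^[j] ⁻¹' {v | chartNorm I ζ v ≠ 1}ᶜ) = 0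
    rw [addHaar_preimage_iterate]
    exact mul_eq_zero_of_right _ (ae_seminorm_ne volume (continuous_chartNorm I ζ) one_ne_zero)
  filter_upwards [hne] with v hv
  exact ((hasVelocity_blowUp hζ v).iterate hfix hF j).eventually_mem_ball_iff hv

variable [MeasurableSpace M] [BorelSpace M]

lemma hasBlowUp_exitSet_ball (hζ : I.IsInteriorPoint ζ) (hFm : Measurable F)
    (hfix : Function.IsFixedPt F ζ)
    (hF : HasMFDerivAt I I F ζ (L : EuclideanSpace ℝ (Fin d) →L[ℝ] EuclideanSpace ℝ (Fin d))) :
    HasBlowUp I ζ (fun r => exitSet F (Metric.ball ζ r))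
      (exitSet L ((chartNorm I ζ).ball 0 1)) where
  measurableSet _ := measurableSet_exitSet hFm Metric.isOpen_ball.measurableSet
  subset_ball _ := sdiff_subset
  measurableSet_limit := measurableSet_exitSet L.continuous.measurable
    (isOpen_seminorm_ball (continuous_chartNorm I ζ) 1).measurableSet
  eventually_mem_iff := by
    filter_upwards [ae_eventually_iterate_mem_ball_iff hζ hfix hF] with v hv
    filter_upwards [hv 0, hv 1] with r h₀ h₁
    exact and_congr h₀ (not_congr h₁)

lemma hasBlowUp_exitSet_inter_preimage (hζ : I.IsInteriorPoint ζ) (hFm : Measurable F)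
    (hfix : Function.IsFixedPt F ζ)
    (hF : HasMFDerivAt I I F ζ (L : EuclideanSpace ℝ (Fin d) →L[ℝ] EuclideanSpace ℝ (Fin d)))
    (j : ℕ) :
    HasBlowUp I ζ
      (fun r => exitSet F (Metric.ball ζ r) ∩ F^[j] ⁻¹' exitSet F (Metric.ball ζ r))
      (exitSet L ((chartNorm I ζ).ball 0 1) ∩
        L^[j] ⁻¹' exitSet L ((chartNorm I ζ).ball 0 1)) where
  measurableSet r := by
    have h := (hasBlowUp_exitSet_ball hζ hFm hfix hF).measurableSet r
    exact h.inter (hFm.iterate j h)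
  subset_ball _ := inter_subset_left.trans sdiff_subset
  measurableSet_limit := by
    have h := (hasBlowUp_exitSet_ball hζ hFm hfix hF).measurableSet_limit
    exact h.inter (L.continuous.measurable.iterate j h)
  eventually_mem_iff := by
    filter_upwards [ae_eventually_iterate_mem_ball_iff hζ hfix hF] with v hv
    filter_upwards [hv 0, hv 1, hv j, hv (j + 1)] with r h₀ h₁ hj hj₁
    simp only [Function.iterate_succ_apply'] at hj₁
    exact and_congr (and_congr h₀ (not_congr h₁)) (and_congr hj (not_congr hj₁))

variable {m : Measure M} {c : ℝ}

lemma HasTangentDensity.exists_tendsto_measureReal_exitSet_div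
    (hm : HasTangentDensity I m ζ c) (hc : 0 < c) (hζ : I.IsInteriorPoint ζ) (hFm : Measurable F)
    (hfix : Function.IsFixedPt F ζ)
    (hF : HasMFDerivAt I I F ζ (L : EuclideanSpace ℝ (Fin d) →L[ℝ] EuclideanSpace ℝ (Fin d))) :
    ∃ κ, 1 - |(L.symm : EuclideanSpace ℝ (Fin d) →L[ℝ] EuclideanSpace ℝ (Fin d)).det| ≤ κ ∧
      Tendsto (fun r => m.real (exitSet F (Metric.ball ζ r)) / m.real (Metric.ball ζ r))
        (𝓝[>] 0) (𝓝 κ) := by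
  obtain ⟨C, hC, hnorm⟩ := exists_norm_le_chartNorm I ζ
  refine ⟨_, ?_, hm.tendsto_measureReal_div_ball hc hζ (hasBlowUp_exitSet_ball hζ hFm hfix hF)⟩
  rw [le_div_iff₀ (volume_real_chartNorm_ball_pos I ζ)]
  exact le_addHaar_real_exitSet volume
    (isOpen_seminorm_ball (continuous_chartNorm I ζ) 1).measurableSet
    (addHaar_seminorm_ball_lt_top volume hC hnorm 1).ne

lemma HasTangentDensity.addHaar_exitSet_inter_preimage_eq_zero (hm : HasTangentDensity I m ζ c)
    (hc : 0 < c) (hζ : I.IsInteriorPoint ζ) (hFm : Measurable F) (hfix : Function.IsFixedPt F ζ)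
    (hF : HasMFDerivAt I I F ζ (L : EuclideanSpace ℝ (Fin d) →L[ℝ] EuclideanSpace ℝ (Fin d)))
    {ι : Type*} {l : Filter ι} [l.NeBot] {r : ι → ℝ} (hr : Tendsto r l (𝓝[>] 0)) {j : ℕ}
    (hret : Tendsto (fun i => m.real (exitSet F (Metric.ball ζ (r i)) ∩
      F^[j] ⁻¹' exitSet F (Metric.ball ζ (r i))) / m.real (Metric.ball ζ (r i))) l (𝓝 0)) :
    volume (exitSet L ((chartNorm I ζ).ball 0 1) ∩
      L^[j] ⁻¹' exitSet L ((chartNorm I ζ).ball 0 1)) = 0 := by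
  obtain ⟨C, hC, hnorm⟩ := exists_norm_le_chartNorm I ζ
  have hzero := tendsto_nhds_unique ((hm.tendsto_measureReal_div_ball hc hζ
    (hasBlowUp_exitSet_inter_preimage hζ hFm hfix hF j)).comp hr) hret
  exact (measureReal_eq_zero_iff (ne_top_of_le_ne_top
    (addHaar_seminorm_ball_lt_top volume hC hnorm 1).ne
    (measure_mono (inter_subset_left.trans sdiff_subset)))).1
    ((div_eq_zero_iff.1 hzero).resolve_right (volume_real_chartNorm_ball_pos I ζ).ne')

lemma HasTangentDensity.tendsto_measureReal_exitSet_div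
    (hm : HasTangentDensity I m ζ c) (hc : 0 < c) (hζ : I.IsInteriorPoint ζ) (hFm : Measurable F)
    (hfix : Function.IsFixedPt F ζ)
    (hF : HasMFDerivAt I I F ζ (L : EuclideanSpace ℝ (Fin d) →L[ℝ] EuclideanSpace ℝ (Fin d)))
    (hdet : |(L.symm : EuclideanSpace ℝ (Fin d) →L[ℝ] EuclideanSpace ℝ (Fin d)).det| < 1)
    (hcontr : ∀ v, Tendsto (fun k : ℕ => L.symm^[k] v) atTop (𝓝 0))
    {ι : Type*} {l : Filter ι} [l.NeBot] {r : ι → ℝ} (hr : Tendsto r l (𝓝[>] 0))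
    (hret : ∀ j ≥ 1, Tendsto (fun i => m.real (exitSet F (Metric.ball ζ (r i)) ∩
      F^[j] ⁻¹' exitSet F (Metric.ball ζ (r i))) / m.real (Metric.ball ζ (r i))) l (𝓝 0)) :
    Tendsto (fun r => m.real (exitSet F (Metric.ball ζ r)) / m.real (Metric.ball ζ r)) (𝓝[>] 0)
      (𝓝 (1 - |(L.symm : EuclideanSpace ℝ (Fin d) →L[ℝ] EuclideanSpace ℝ (Fin d)).det|)) := by
  obtain ⟨C, hC, hnorm⟩ := exists_norm_le_chartNorm I ζ
  have hopen := isOpen_seminorm_ball (continuous_chartNorm I ζ) 1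
  have hexit := addHaar_real_exitSet_eq volume hdet hcontr
    (hopen.mem_nhds ((chartNorm I ζ).mem_ball_self one_pos)) hopen.measurableSet
    (addHaar_seminorm_ball_lt_top volume hC hnorm 1).ne fun j hj =>
      hm.addHaar_exitSet_inter_preimage_eq_zero hc hζ hFm hfix hF hr (hret j hj)
  have hlim := hm.tendsto_measureReal_div_ball hc hζ (hasBlowUp_exitSet_ball hζ hFm hfix hF)
  rwa [hexit, mul_div_cancel_right₀ _ (volume_real_chartNorm_ball_pos I ζ).ne'] at hlim

end FixedPoint

/-- The points whose orbit avoids `A` at the times `0, …, ℓ - 1`. -/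
def avoid {M : Type*} (f : M → M) (A : Set M) (ℓ : ℕ) : Set M := {x | ∀ i < ℓ, f^[i] x ∉ A}

section Avoid

variable {M : Type*} {f : M → M} {A B : Set M}

@[simp]
lemma avoid_zero : avoid f A 0 = univ := by simp [avoid]

@[simp]
lemma avoid_one : avoid f A 1 = Aᶜ := by ext; simp [avoid]

lemma avoid_add (m n : ℕ) : avoid f A (m + n) = avoid f A m ∩ f^[m] ⁻¹' avoid f A n := by
  ext x
  simp only [avoid, mem_inter_iff, mem_preimage, mem_ofPred_eq, ← Function.iterate_add_apply]
  refine ⟨fun h => ⟨fun i hi => h i (by omega), fun i hi => h (i + m) (by omega)⟩,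
    fun h i hi => ?_⟩
  rcases lt_or_ge i m with him | him
  · exact h.1 i him
  · simpa only [Nat.sub_add_cancel him] using h.2 (i - m) (by omega)

lemma avoid_succ (n : ℕ) : avoid f A (n + 1) = f ⁻¹' avoid f A n \ A := by
  rw [add_comm, avoid_add, avoid_one, inter_comm, sdiff_eq, Function.iterate_one]

lemma antitone_avoid : Antitone (avoid f A) := fun _ _ h _ hx i hi => hx i (hi.trans_le h)

lemma avoid_subset_avoid (h : A ⊆ B) (ℓ : ℕ) : avoid f B ℓ ⊆ avoid f A ℓ :=
  fun _ hx i hi hA => hx i hi (h hA)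

lemma compl_avoid (ℓ : ℕ) : (avoid f A ℓ)ᶜ = ⋃ i ∈ Finset.range ℓ, f^[i] ⁻¹' A := by
  ext x
  simp [avoid]

lemma avoid_exitSet_inter_subset_avoid {p : ℕ} (hp : 0 < p) (ℓ : ℕ) :
    avoid f (exitSet f^[p] A) ℓ ∩ f^[ℓ] ⁻¹' avoid f A p ⊆ avoid f A ℓ := by
  rintro x ⟨hexit, hlast⟩
  suffices ∀ n i, ℓ ≤ i + n → i < ℓ + p → f^[i] x ∉ A from
    fun i hi => this (ℓ - i) i (by omega) (by omega)
  intro n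
  induction n using Nat.strong_induction_on with
  | _ n ih =>
    intro i hin hi hmem
    rcases lt_or_ge i ℓ with hiℓ | hiℓ
    · refine hexit i hiℓ ⟨hmem, ?_⟩
      rw [mem_preimage, ← Function.iterate_add_apply, add_comm]
      exact ih (n - p) (by omega) (i + p) (by omega) (by omega)
    · refine hlast (i - ℓ) (by omega) ?_
      rwa [← Function.iterate_add_apply, Nat.sub_add_cancel hiℓ]

variable [MeasurableSpace M]

lemma measurableSet_avoid (hf : Measurable f) (hA : MeasurableSet A) (ℓ : ℕ) :
    MeasurableSet (avoid f A ℓ) := by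
  rw [← MeasurableSet.compl_iff, compl_avoid]
  exact Finset.measurableSet_biUnion _ fun i _ => hf.iterate i hA

variable {μ : Measure M}

lemma measureReal_preimage_iterate (hf : MeasurePreserving f μ μ) (hA : MeasurableSet A) (i : ℕ) :
    μ.real (f^[i] ⁻¹' A) = μ.real A :=
  (hf.iterate i).measureReal_preimage hA.nullMeasurableSet

lemma measureReal_compl_avoid_le (hf : MeasurePreserving f μ μ) (hA : MeasurableSet A) (ℓ : ℕ) :
    μ.real (avoid f A ℓ)ᶜ ≤ ℓ * μ.real A := by
  rw [compl_avoid]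
  refine (measureReal_biUnion_finset_le _ _).trans_eq ?_
  simp only [measureReal_preimage_iterate hf hA, Finset.sum_const, Finset.card_range, nsmul_eq_mul]

variable [IsFiniteMeasure μ]

lemma measureReal_le_inter_preimage_avoid_add (hf : MeasurePreserving f μ μ)
    (hA : MeasurableSet A) (B : Set M) (i ℓ : ℕ) :
    μ.real B ≤ μ.real (B ∩ f^[i] ⁻¹' avoid f A ℓ) + ℓ * μ.real A := by
  have hm := measurableSet_avoid hf.measurable hA ℓ
  calc μ.real B ≤ μ.real (B ∩ f^[i] ⁻¹' avoid f A ℓ ∪ f^[i] ⁻¹' (avoid f A ℓ)ᶜ) :=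
        measureReal_mono fun x hx => or_iff_not_imp_right.2 fun h => ⟨hx, not_not.1 h⟩
    _ ≤ μ.real (B ∩ f^[i] ⁻¹' avoid f A ℓ) + μ.real (f^[i] ⁻¹' (avoid f A ℓ)ᶜ) :=
        measureReal_union_le _ _
    _ ≤ _ := by
        rw [measureReal_preimage_iterate hf hm.compl]
        gcongr
        exact measureReal_compl_avoid_le hf hA ℓ

lemma abs_measureReal_avoid_sub_avoid_le_mul (hf : MeasurePreserving f μ μ)
    (hA : MeasurableSet A) (m n : ℕ) :
    |μ.real (avoid f A m) - μ.real (avoid f A n)| ≤ |(m : ℝ) - n| * μ.real A := by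
  wlog hmn : m ≤ n generalizing m n
  · rw [abs_sub_comm, abs_sub_comm (m : ℝ)]
    exact this n m (le_of_not_ge hmn)
  obtain ⟨k, rfl⟩ := Nat.exists_eq_add_of_le hmn
  have hmono := measureReal_mono (μ := μ) (antitone_avoid (f := f) (A := A) hmn)
  have hle := measureReal_le_inter_preimage_avoid_add hf hA (avoid f A m) m k
  rw [← avoid_add] at hle
  rw [abs_of_nonneg (sub_nonneg.2 hmono), Nat.cast_add, sub_add_cancel_left, abs_neg, Nat.abs_cast]
  exact sub_le_iff_le_add'.2 hle

lemma abs_measureReal_avoid_sub_avoid_le_abs_sub (hf : MeasurePreserving f μ μ)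
    (hA : MeasurableSet A) (hB : MeasurableSet B) (h : A ⊆ B ∨ B ⊆ A) (ℓ : ℕ) :
    |μ.real (avoid f A ℓ) - μ.real (avoid f B ℓ)| ≤ ℓ * |μ.real A - μ.real B| := by
  wlog hAB : A ⊆ B generalizing A B
  · rw [abs_sub_comm, abs_sub_comm (μ.real A)]
    exact this hB hA h.symm (h.resolve_left hAB)
  have hsub : avoid f A ℓ ∩ f^[0] ⁻¹' avoid f (B \ A) ℓ ⊆ avoid f B ℓ :=
    fun x hx i hi hB => hx.2 i hi ⟨hB, hx.1 i hi⟩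
  have hle := measureReal_le_inter_preimage_avoid_add hf (hB.diff hA) (avoid f A ℓ) 0 ℓ
  rw [abs_of_nonneg (sub_nonneg.2 (measureReal_mono (avoid_subset_avoid hAB ℓ))),
    abs_sub_comm, abs_of_nonneg (sub_nonneg.2 (measureReal_mono hAB)), sub_le_iff_le_add',
    ← measureReal_sdiff hAB hA]
  exact hle.trans (add_le_add_left (measureReal_mono hsub) _)

lemma abs_measureReal_avoid_sub_avoid_exitSet_le (hf : MeasurePreserving f μ μ)
    (hA : MeasurableSet A) {p : ℕ} (hp : 0 < p) (ℓ : ℕ) :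
    |μ.real (avoid f A ℓ) - μ.real (avoid f (exitSet f^[p] A) ℓ)| ≤ p * μ.real A := by
  have hmono : avoid f A ℓ ⊆ avoid f (exitSet f^[p] A) ℓ := avoid_subset_avoid sdiff_subset ℓ
  rw [abs_sub_comm, abs_of_nonneg (sub_nonneg.2 (measureReal_mono hmono)), sub_le_iff_le_add']
  exact (measureReal_le_inter_preimage_avoid_add hf hA _ ℓ p).trans
    (add_le_add_left (measureReal_mono (avoid_exitSet_inter_subset_avoid hp ℓ)) _)

end Avoid

section Blocks

variable {M : Type*} [MeasurableSpace M] {μ : Measure M} [IsFiniteMeasure μ] {f : M → M}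
  {A W : Set M} {γ : ℝ} {T : ℕ}

lemma measureReal_inter_preimage_le_add_sum (n : ℕ) (V : Set M) :
    μ.real (A ∩ f ⁻¹' V) ≤ μ.real (A ∩ f ⁻¹' (avoid f A n ∩ V)) +
      ∑ j ∈ Finset.Icc 1 n, μ.real (A ∩ f^[j] ⁻¹' A) := by
  have hsub : A ∩ f ⁻¹' V ⊆
      A ∩ f ⁻¹' (avoid f A n ∩ V) ∪ ⋃ j ∈ Finset.Icc 1 n, A ∩ f^[j] ⁻¹' A := by
    rintro x ⟨hxA, hxV⟩
    refine or_iff_not_imp_right.2 fun h => ⟨hxA, fun i hi hmem => h ?_, hxV⟩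
    exact mem_iUnion₂.2 ⟨i + 1, Finset.mem_Icc.2 ⟨by omega, by omega⟩, hxA, hmem⟩
  exact (measureReal_mono hsub).trans ((measureReal_union_le _ _).trans
    (add_le_add_right (measureReal_biUnion_finset_le _ _) _))

lemma abs_measureReal_avoid_inter_preimage_sub_le (hf : MeasurePreserving f μ μ)
    (hA : MeasurableSet A) (hW : MeasurableSet W)
    (hmix : ∀ t ≥ T, |μ.real (A ∩ f^[t] ⁻¹' W) - μ.real A * μ.real W| ≤ γ) {b B : ℕ}
    (hb : b ≤ B) :
    |μ.real (avoid f A b ∩ f^[b + T] ⁻¹' W) - (1 - b * μ.real A) * μ.real W| ≤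
      b * (γ + ∑ j ∈ Finset.Icc 1 B, μ.real (A ∩ f^[j] ⁻¹' A)) := by
  induction b with
  | zero => simp [measureReal_preimage_iterate hf hW]
  | succ b ih =>
    let V := f^[b + T] ⁻¹' W
    have hV : MeasurableSet V := hf.measurable.iterate _ hW
    have hVb : f ⁻¹' V = f^[b + 1 + T] ⁻¹' W := by
      rw [← preimage_comp, ← Function.iterate_succ, Nat.succ_eq_add_one, Nat.add_right_comm]
    have hsplit : μ.real (avoid f A (b + 1) ∩ f^[b + 1 + T] ⁻¹' W) =
        μ.real (avoid f A b ∩ V) - μ.real (A ∩ f ⁻¹' (avoid f A b ∩ V)) := by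
      have hm := (measurableSet_avoid hf.measurable hA b).inter hV
      rw [← hf.measureReal_preimage hm.nullMeasurableSet, ← hVb, avoid_succ, sdiff_inter_right_comm,
        ← preimage_inter, inter_comm A]
      exact eq_sub_of_add_eq' (measureReal_inter_add_sdiff hA)
    have hupper : μ.real (A ∩ f ⁻¹' (avoid f A b ∩ V)) ≤ μ.real (A ∩ f ⁻¹' V) :=
      measureReal_mono (inter_subset_inter_right _ (preimage_mono inter_subset_right))
    have hlower := measureReal_inter_preimage_le_add_sum (μ := μ) (f := f) (A := A) b V
    have hsum : ∑ j ∈ Finset.Icc 1 b, μ.real (A ∩ f^[j] ⁻¹' A) ≤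
        ∑ j ∈ Finset.Icc 1 B, μ.real (A ∩ f^[j] ⁻¹' A) :=
      Finset.sum_le_sum_of_subset_of_nonneg (Finset.Icc_subset_Icc_right (by omega))
        fun _ _ _ => measureReal_nonneg
    have hsum_nonneg : 0 ≤ ∑ j ∈ Finset.Icc 1 b, μ.real (A ∩ f^[j] ⁻¹' A) :=
      Finset.sum_nonneg fun _ _ => measureReal_nonneg
    have hγ := abs_le.1 (hVb ▸ hmix (b + 1 + T) (by omega))
    have ih := abs_le.1 (ih (by omega))
    rw [hsplit, abs_le]
    push_cast
    constructor <;> linarith [hsum_nonneg]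

lemma abs_measureReal_avoid_add_inter_preimage_sub_le (hf : MeasurePreserving f μ μ)
    (hA : MeasurableSet A) (hW : MeasurableSet W)
    (hmix : ∀ t ≥ T, |μ.real (A ∩ f^[t] ⁻¹' W) - μ.real A * μ.real W| ≤ γ) (b : ℕ) :
    |μ.real (avoid f A (b + T) ∩ f^[b + T] ⁻¹' W) - (1 - b * μ.real A) * μ.real W| ≤
      T * μ.real A + b * (γ + ∑ j ∈ Finset.Icc 1 b, μ.real (A ∩ f^[j] ⁻¹' A)) := by
  have hblock := abs_le.1 (abs_measureReal_avoid_inter_preimage_sub_le hf hA hW hmix (le_refl b))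
  have hgap := measureReal_le_inter_preimage_avoid_add hf hA
    (avoid f A b ∩ f^[b + T] ⁻¹' W) b T
  rw [inter_right_comm, ← avoid_add] at hgap
  have hmono : μ.real (avoid f A (b + T) ∩ f^[b + T] ⁻¹' W) ≤
      μ.real (avoid f A b ∩ f^[b + T] ⁻¹' W) :=
    measureReal_mono (inter_subset_inter_left _ (antitone_avoid (Nat.le_add_right b T)))
  have hnonneg : 0 ≤ T * μ.real A := by positivity
  rw [abs_le]
  constructor <;> linarith [hnonneg]

lemma abs_measureReal_avoid_mul_sub_pow_le {μ : Measure M} [IsProbabilityMeasure μ]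
    (hf : MeasurePreserving f μ μ) (hA : MeasurableSet A)
    (hmix : ∀ ℓ, ∀ t ≥ T,
      |μ.real (A ∩ f^[t] ⁻¹' avoid f A ℓ) - μ.real A * μ.real (avoid f A ℓ)| ≤ γ)
    {b : ℕ} (hb : b * μ.real A ≤ 1) (m : ℕ) :
    |μ.real (avoid f A (m * (b + T))) - (1 - b * μ.real A) ^ m| ≤
      m * (T * μ.real A + b * (γ + ∑ j ∈ Finset.Icc 1 b, μ.real (A ∩ f^[j] ⁻¹' A))) := by
  induction m with
  | zero => simp
  | succ m ih =>
    have hstep := abs_measureReal_avoid_add_inter_preimage_sub_le hf hA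
      (measurableSet_avoid hf.measurable hA _) (hmix (m * (b + T))) b
    rw [← avoid_add] at hstep
    have hx : 0 ≤ 1 - b * μ.real A := sub_nonneg.2 hb
    have hx' : 1 - b * μ.real A ≤ 1 := sub_le_self _ (by positivity)
    have hprod : |(1 - b * μ.real A) * μ.real (avoid f A (m * (b + T))) -
        (1 - b * μ.real A) ^ (m + 1)| ≤
        m * (T * μ.real A + b * (γ + ∑ j ∈ Finset.Icc 1 b, μ.real (A ∩ f^[j] ⁻¹' A))) := by
      rw [pow_succ', ← mul_sub, abs_mul, abs_of_nonneg hx]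
      exact (mul_le_of_le_one_left (abs_nonneg _) hx').trans ih
    rw [add_mul, one_mul, add_comm (m * (b + T))]
    refine (abs_sub_le _ _ _).trans ((add_le_add hstep hprod).trans_eq ?_)
    push_cast
    ring

end Blocks

section ExponentialLaw

lemma tendsto_one_sub_pow_exp {ι : Type*} {l : Filter ι} {x : ι → ℝ} {m : ι → ℕ} {c : ℝ}
    (hx : Tendsto x l (𝓝 0)) (hmx : Tendsto (fun i => (m i : ℝ) * x i) l (𝓝 c)) :
    Tendsto (fun i => (1 - x i) ^ m i) l (𝓝 (Real.exp (-c))) := by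
  have hderiv : HasDerivAt (fun y : ℝ => Real.log (1 - y)) (-1) 0 := by
    simpa using ((hasDerivAt_id (0 : ℝ)).const_sub 1).log (by simp)
  have hslope : Tendsto (fun i => dslope (fun y => Real.log (1 - y)) 0 (x i)) l (𝓝 (-1)) := by
    have hcont := (continuousAt_dslope_same.2 hderiv.differentiableAt).tendsto
    rw [dslope_same, hderiv.deriv] at hcont
    exact hcont.comp hx
  have hexp := (Real.continuous_exp.tendsto _).comp (hmx.mul hslope)
  rw [mul_neg_one] at hexp
  refine hexp.congr' ?_
  filter_upwards [hx.eventually_lt_const one_pos] with i hi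
  have hlog := sub_smul_dslope (fun y => Real.log (1 - y)) 0 (x i)
  simp only [sub_zero, smul_eq_mul, Real.log_one] at hlog
  rw [Function.comp_apply, mul_assoc, hlog, Real.exp_nat_mul, Real.exp_log (sub_pos.2 hi)]

lemma tendsto_mul_of_tendsto_div {ι : Type*} {l : Filter ι} {a v w : ι → ℝ} {c e : ℝ}
    (hw : ∀ᶠ i in l, w i ≠ 0) (ha : Tendsto (fun i => a i / w i) l (𝓝 c))
    (hv : Tendsto (fun i => w i * v i) l (𝓝 e)) :
    Tendsto (fun i => a i * v i) l (𝓝 (c * e)) := by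
  refine (ha.mul hv).congr' ?_
  filter_upwards [hw] with i hi
  rw [← mul_assoc, div_mul_cancel₀ _ hi]

lemma tendsto_zero_of_tendsto_natCast_mul {x : ℕ → ℝ} {c : ℝ}
    (hx : Tendsto (fun n : ℕ => (n : ℝ) * x n) atTop (𝓝 c)) : Tendsto x atTop (𝓝 0) := by
  refine (hx.div_atTop tendsto_natCast_atTop_atTop).congr' ?_
  filter_upwards [eventually_ne_atTop 0] with n hn
  exact mul_div_cancel_left₀ _ (Nat.cast_ne_zero.2 hn)

variable {M : Type*} [MeasurableSpace M]

/-- The content of the conditions `CondDp` and `CondDp'` for a sequence of events `Q n`: after a gap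
`T n` they decorrelate up to an error `γ n = o(1/n)`, they do not recur within the block length
`n / k n`, and the gaps are negligible compared with the blocks. -/
structure MixesWithoutClustering (μ : Measure M) (f : M → M) (Q : ℕ → Set M) (T k : ℕ → ℕ)
    (γ : ℕ → ℝ) : Prop where
  measurableSet : ∀ᶠ n in atTop, MeasurableSet (Q n)
  abs_sub_le : ∀ᶠ n in atTop, ∀ ℓ, ∀ t ≥ T n, |μ.real (Q n ∩ f^[t] ⁻¹' avoid f (Q n) ℓ) -
    μ.real (Q n) * μ.real (avoid f (Q n) ℓ)| ≤ γ n
  tendsto_error : Tendsto (fun n : ℕ => (n : ℝ) * γ n) atTop (𝓝 0)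
  tendsto_blocks : Tendsto k atTop atTop
  tendsto_gaps : Tendsto (fun n : ℕ => (k n : ℝ) * T n / n) atTop (𝓝 0)
  tendsto_recurrence : Tendsto (fun n : ℕ => (n : ℝ) * ∑ j ∈ Finset.Icc 1 (n / k n),
    μ.real (Q n ∩ f^[j] ⁻¹' Q n)) atTop (𝓝 0)

namespace MixesWithoutClustering

variable {μ : Measure M} {f : M → M} {Q Q' : ℕ → Set M} {T k : ℕ → ℕ} {γ : ℕ → ℝ} {κ s : ℝ}

lemma congr (h : MixesWithoutClustering μ f Q T k γ) (hQ : Q =ᶠ[atTop] Q') :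
    MixesWithoutClustering μ f Q' T k γ where
  measurableSet := by
    filter_upwards [h.measurableSet, hQ] with n hn hQn
    rwa [← hQn]
  abs_sub_le := by
    filter_upwards [h.abs_sub_le, hQ] with n hn hQn
    rwa [← hQn]
  tendsto_error := h.tendsto_error
  tendsto_blocks := h.tendsto_blocks
  tendsto_gaps := h.tendsto_gaps
  tendsto_recurrence := h.tendsto_recurrence.congr' <| by
    filter_upwards [hQ] with n hQn
    rw [hQn]

lemma tendsto_floor_blocks_mul_div (h : MixesWithoutClustering μ f Q T k γ) (hs : 0 ≤ s)
    {x : ℕ → ℝ} {c : ℝ} (hx : Tendsto (fun n : ℕ => k n * x n / n) atTop (𝓝 c)) :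
    Tendsto (fun n : ℕ => ⌊s * k n⌋₊ * x n / n) atTop (𝓝 (s * c)) := by
  have hfloor : Tendsto (fun n => (⌊s * k n⌋₊ : ℝ) / k n) atTop (𝓝 s) :=
    (tendsto_nat_floor_mul_div_atTop hs).comp
      (tendsto_natCast_atTop_atTop.comp h.tendsto_blocks)
  refine (hfloor.mul hx).congr' ?_
  filter_upwards [h.tendsto_blocks.eventually_gt_atTop 0] with n hk
  field_simp

variable [IsProbabilityMeasure μ]

-- Without a gap, the mixing bound at `ℓ = 1` compares `μ (Q n ∩ (Q n)ᶜ) = 0` with a product.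
lemma eventually_gap_pos (h : MixesWithoutClustering μ f Q T k γ) (hκ : 0 < κ)
    (hQ : Tendsto (fun n : ℕ => (n : ℝ) * μ.real (Q n)) atTop (𝓝 κ)) :
    ∀ᶠ n in atTop, 1 ≤ T n := by
  have hQ0 := tendsto_zero_of_tendsto_natCast_mul hQ
  have hprod : Tendsto (fun n : ℕ => n * μ.real (Q n) * (1 - μ.real (Q n))) atTop (𝓝 κ) := by
    simpa only [sub_zero, mul_one] using hQ.mul (hQ0.const_sub 1)
  filter_upwards [h.tendsto_error.eventually_lt hprod hκ, h.measurableSet, h.abs_sub_le]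
    with n hlt hm hmix
  by_contra hT
  have hbound := hmix 1 0 (by omega)
  rw [avoid_one, Function.iterate_zero, preimage_id, inter_compl_self, measureReal_empty,
    probReal_compl_eq_one_sub hm, zero_sub, abs_neg] at hbound
  refine hlt.not_ge ?_
  rw [mul_assoc]
  exact mul_le_mul_of_nonneg_left (le_of_abs_le hbound) n.cast_nonneg

lemma tendsto_div_blocks (h : MixesWithoutClustering μ f Q T k γ) (hκ : 0 < κ)
    (hQ : Tendsto (fun n : ℕ => (n : ℝ) * μ.real (Q n)) atTop (𝓝 κ)) :
    Tendsto (fun n : ℕ => (n : ℝ) / k n) atTop atTop := by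
  have hinv : Tendsto (fun n : ℕ => (k n : ℝ) / n) atTop (𝓝[>] 0) := by
    refine tendsto_nhdsWithin_iff.2 ⟨squeeze_zero' (.of_forall fun n => by positivity) ?_
      h.tendsto_gaps, ?_⟩
    · filter_upwards [h.eventually_gap_pos hκ hQ] with n hT
      gcongr
      exact le_mul_of_one_le_right (Nat.cast_nonneg _) (Nat.one_le_cast.2 hT)
    · filter_upwards [h.tendsto_blocks.eventually_gt_atTop 0, eventually_gt_atTop 0] with n hk hn
      exact mem_Ioi.2 (by positivity)
  exact hinv.inv_tendsto_nhdsGT_zero.congr fun n => inv_div _ _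

lemma tendsto_mul_inter_preimage (h : MixesWithoutClustering μ f Q T k γ) (hκ : 0 < κ)
    (hQ : Tendsto (fun n : ℕ => (n : ℝ) * μ.real (Q n)) atTop (𝓝 κ)) {j : ℕ} (hj : 1 ≤ j) :
    Tendsto (fun n : ℕ => (n : ℝ) * μ.real (Q n ∩ f^[j] ⁻¹' Q n)) atTop (𝓝 0) := by
  refine squeeze_zero' (.of_forall fun n => by positivity) ?_ h.tendsto_recurrence
  filter_upwards [(h.tendsto_div_blocks hκ hQ).eventually_ge_atTop (j : ℝ)] with n hjn
  have hmem : j ∈ Finset.Icc 1 (n / k n) := by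
    rw [Finset.mem_Icc, ← Nat.floor_div_eq_div (K := ℝ)]
    exact ⟨hj, Nat.le_floor hjn⟩
  gcongr
  exact Finset.single_le_sum (f := fun j => μ.real (Q n ∩ f^[j] ⁻¹' Q n))
    (fun _ _ => measureReal_nonneg) hmem

lemma tendsto_blocks_mul_length_div (h : MixesWithoutClustering μ f Q T k γ) (hκ : 0 < κ)
    (hQ : Tendsto (fun n : ℕ => (n : ℝ) * μ.real (Q n)) atTop (𝓝 κ)) :
    Tendsto (fun n : ℕ => (k n : ℝ) * (n / k n : ℕ) / n) atTop (𝓝 1) := by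
  refine ((tendsto_nat_floor_div_atTop (R := ℝ)).comp (h.tendsto_div_blocks hκ hQ)).congr
    fun n => ?_
  rw [Function.comp_apply, Nat.floor_div_eq_div, div_div_eq_mul_div, mul_comm]

lemma tendsto_length_mul_measureReal (h : MixesWithoutClustering μ f Q T k γ) (hκ : 0 < κ)
    (hQ : Tendsto (fun n : ℕ => (n : ℝ) * μ.real (Q n)) atTop (𝓝 κ)) :
    Tendsto (fun n : ℕ => ((n / k n : ℕ) : ℝ) * μ.real (Q n)) atTop (𝓝 0) := by
  have hlength : Tendsto (fun n : ℕ => ((n / k n : ℕ) : ℝ) / n) atTop (𝓝 0) := by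
    refine ((h.tendsto_blocks_mul_length_div hκ hQ).div_atTop
      (tendsto_natCast_atTop_atTop.comp h.tendsto_blocks)).congr' ?_
    filter_upwards [h.tendsto_blocks.eventually_gt_atTop 0] with n hk
    rw [Function.comp_apply]
    field_simp
  simpa only [zero_mul] using
    tendsto_mul_of_tendsto_div (tendsto_natCast_atTop_atTop.eventually_ne_atTop 0) hlength hQ

-- The number `⌊s * k n⌋₊` of blocks is chosen so that they cover a time asymptotic to `s * n`.
lemma tendsto_measureReal_avoid_blocks (h : MixesWithoutClustering μ f Q T k γ)
    (hf : MeasurePreserving f μ μ) (hκ : 0 < κ)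
    (hQ : Tendsto (fun n : ℕ => (n : ℝ) * μ.real (Q n)) atTop (𝓝 κ)) (hs : 0 ≤ s) :
    Tendsto (fun n => μ.real (avoid f (Q n) (⌊s * k n⌋₊ * (n / k n + T n)))) atTop
      (𝓝 (Real.exp (-(s * κ)))) := by
  have hn : ∀ᶠ n : ℕ in atTop, (n : ℝ) ≠ 0 := tendsto_natCast_atTop_atTop.eventually_ne_atTop 0
  have hblocks := h.tendsto_floor_blocks_mul_div hs (h.tendsto_blocks_mul_length_div hκ hQ)
  have hgaps := h.tendsto_floor_blocks_mul_div hs h.tendsto_gaps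
  rw [mul_one] at hblocks
  have hlength := h.tendsto_length_mul_measureReal hκ hQ
  have hpow : Tendsto (fun n => (1 - (n / k n : ℕ) * μ.real (Q n)) ^ ⌊s * k n⌋₊) atTop
      (𝓝 (Real.exp (-(s * κ)))) := by
    refine tendsto_one_sub_pow_exp hlength ?_
    simpa only [mul_assoc] using tendsto_mul_of_tendsto_div hn hblocks hQ
  have herror : Tendsto (fun n => ⌊s * k n⌋₊ * (T n * μ.real (Q n) + (n / k n : ℕ) *
      (γ n + ∑ j ∈ Finset.Icc 1 (n / k n), μ.real (Q n ∩ f^[j] ⁻¹' Q n)))) atTop (𝓝 0) := by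
    have hsum := (tendsto_mul_of_tendsto_div hn hgaps hQ).add
      ((tendsto_mul_of_tendsto_div hn hblocks h.tendsto_error).add
        (tendsto_mul_of_tendsto_div hn hblocks h.tendsto_recurrence))
    simp only [mul_zero, zero_mul, add_zero] at hsum
    exact hsum.congr fun n => by ring
  have hdiff : Tendsto (fun n => μ.real (avoid f (Q n) (⌊s * k n⌋₊ * (n / k n + T n))) -
      (1 - (n / k n : ℕ) * μ.real (Q n)) ^ ⌊s * k n⌋₊) atTop (𝓝 0) := by
    refine squeeze_zero_norm' ?_ herror
    filter_upwards [h.measurableSet, h.abs_sub_le, hlength.eventually_le_const one_pos]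
      with n hm hmix hle
    exact abs_measureReal_avoid_mul_sub_pow_le hf hm hmix hle _
  simpa only [sub_add_cancel, zero_add] using hdiff.add hpow

lemma tendsto_measureReal_avoid (h : MixesWithoutClustering μ f Q T k γ)
    (hf : MeasurePreserving f μ μ) (hκ : 0 < κ)
    (hQ : Tendsto (fun n : ℕ => (n : ℝ) * μ.real (Q n)) atTop (𝓝 κ)) (hs : 0 ≤ s)
    {ι : Type*} {l : Filter ι} {m N : ι → ℕ} (hm : Tendsto m l atTop)
    (hN : Tendsto (fun i => (N i : ℝ) / m i) l (𝓝 s)) :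
    Tendsto (fun i => μ.real (avoid f (Q (m i)) (N i))) l (𝓝 (Real.exp (-(s * κ)))) := by
  let R : ℕ → ℕ := fun n => ⌊s * k n⌋₊ * (n / k n + T n)
  have hR : Tendsto (fun n => (R n : ℝ) / n) atTop (𝓝 s) := by
    have hsum := (h.tendsto_floor_blocks_mul_div hs (h.tendsto_blocks_mul_length_div hκ hQ)).add
      (h.tendsto_floor_blocks_mul_div hs h.tendsto_gaps)
    rw [mul_one, mul_zero, add_zero] at hsum
    refine hsum.congr fun n => ?_
    simp only [R, Nat.cast_mul, Nat.cast_add, mul_add, add_div]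
  have htime : Tendsto (fun i => |(N i : ℝ) - R (m i)| / m i) l (𝓝 0) := by
    have habs := (hN.sub (hR.comp hm)).abs
    rw [sub_self, abs_zero] at habs
    refine habs.congr fun i => ?_
    rw [Function.comp_apply, ← sub_div, abs_div, Nat.abs_cast]
  have herror := tendsto_mul_of_tendsto_div
    ((tendsto_natCast_atTop_atTop.comp hm).eventually_ne_atTop 0) htime (hQ.comp hm)
  rw [zero_mul] at herror
  have hdiff : Tendsto (fun i => μ.real (avoid f (Q (m i)) (N i)) -
      μ.real (avoid f (Q (m i)) (R (m i)))) l (𝓝 0) := by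
    refine squeeze_zero_norm' ?_ herror
    filter_upwards [hm.eventually h.measurableSet] with i hQm
    exact abs_measureReal_avoid_sub_avoid_le_mul hf hQm _ _
  simpa only [R, Function.comp_apply, sub_add_cancel, zero_add] using
    hdiff.add ((h.tendsto_measureReal_avoid_blocks hf hκ hQ hs).comp hm)

end MixesWithoutClustering

end ExponentialLaw

section HittingTime

variable {M : Type*} {f : M → M} {A : Set M}

lemma hittingTime_le_natCast_iff {x : M} {K : ℕ} :
    hittingTime f A x ≤ (K : ℕ∞) ↔ x ∉ f ⁻¹' avoid f A K := by
  have hmem : x ∉ f ⁻¹' avoid f A K ↔ ∃ j, 1 ≤ j ∧ j ≤ K ∧ f^[j] x ∈ A := by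
    simp only [avoid, mem_preimage, mem_ofPred_eq, ← Function.iterate_succ_apply]
    push Not
    exact ⟨fun ⟨i, hi, h⟩ => ⟨i + 1, by omega, by omega, h⟩,
      fun ⟨j, hj, hjK, h⟩ => ⟨j - 1, by omega, by rwa [Nat.succ_eq_add_one, Nat.sub_add_cancel hj]⟩⟩
  rw [hmem, ← ENat.lt_natCast_add_one_iff, hittingTime, iInf_lt_iff]
  simp only [Subtype.exists, ← Nat.cast_add_one, Nat.cast_lt, Order.lt_add_one_iff]
  exact exists_congr fun j => by tauto

lemma enat_toENNReal_le_ofReal_iff {h : ℕ∞} {y : ℝ} (hy : 0 ≤ y) :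
    (h : ℝ≥0∞) ≤ ENNReal.ofReal y ↔ h ≤ (⌊y⌋₊ : ℕ∞) := by
  induction h using ENat.recTopCoe with
  | top => simp
  | coe k => rw [Nat.cast_le, Nat.le_floor_iff hy, ENat.toENNReal_coe, ← ENNReal.ofReal_natCast,
      ENNReal.ofReal_le_ofReal_iff hy]

variable [MeasurableSpace M] {μ : Measure M}

lemma hitLT_subset_hitLE (t : ℝ) : hitLT μ f A t ⊆ hitLE μ f A t :=
  fun _ hx => mem_ofPred_eq ▸ le_of_lt hx

lemma hitLT_zero : hitLT μ f A 0 = ∅ := by simp [hitLT]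

variable [IsProbabilityMeasure μ]

lemma ofReal_div_measure (hA : 0 < μ.real A) (t : ℝ) :
    ENNReal.ofReal t / μ A = ENNReal.ofReal (t / μ.real A) := by
  rw [ENNReal.ofReal_div_of_pos hA, ofReal_measureReal]

lemma hitLE_subset_hitLT (hA : 0 < μ.real A) {s t : ℝ} (hs : 0 ≤ s) (hst : s < t) :
    hitLE μ f A s ⊆ hitLT μ f A t := by
  intro x hx
  rw [hitLE, mem_ofPred_eq] at hx
  rw [hitLT, mem_ofPred_eq]
  refine hx.trans_lt ?_
  rw [ofReal_div_measure hA, ofReal_div_measure hA,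
    ENNReal.ofReal_lt_ofReal_iff_of_nonneg (by positivity)]
  exact div_lt_div_of_pos_right hst hA

lemma hitLE_eq_compl (hA : 0 < μ.real A) {t : ℝ} (ht : 0 ≤ t) :
    hitLE μ f A t = (f ⁻¹' avoid f A ⌊t / μ.real A⌋₊)ᶜ := by
  ext x
  rw [hitLE, mem_ofPred_eq, ofReal_div_measure hA, enat_toENNReal_le_ofReal_iff (by positivity),
    hittingTime_le_natCast_iff, mem_compl_iff]

lemma measureReal_hitLE (hf : MeasurePreserving f μ μ) (hAm : MeasurableSet A)
    (hA : 0 < μ.real A) {t : ℝ} (ht : 0 ≤ t) :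
    μ.real (hitLE μ f A t) = 1 - μ.real (avoid f A ⌊t / μ.real A⌋₊) := by
  have hm := measurableSet_avoid hf.measurable hAm ⌊t / μ.real A⌋₊
  rw [hitLE_eq_compl hA ht, probReal_compl_eq_one_sub (hf.measurable hm),
    hf.measureReal_preimage hm.nullMeasurableSet]

lemma measureReal_inter_preimage_avoid (hf : MeasurePreserving f μ μ) (hAm : MeasurableSet A)
    (K : ℕ) :
    μ.real (A ∩ f ⁻¹' avoid f A K) = μ.real (avoid f A K) - μ.real (avoid f A (K + 1)) := by
  rw [avoid_succ, ← hf.measureReal_preimage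
    (measurableSet_avoid hf.measurable hAm K).nullMeasurableSet, inter_comm]
  exact eq_sub_of_add_eq (measureReal_inter_add_sdiff hAm)

lemma cond_real_hitLE (hf : MeasurePreserving f μ μ) (hAm : MeasurableSet A)
    (hA : 0 < μ.real A) {t : ℝ} (ht : 0 ≤ t) :
    (ProbabilityTheory.cond μ A).real (hitLE μ f A t) =
      1 - (μ.real (avoid f A ⌊t / μ.real A⌋₊) - μ.real (avoid f A (⌊t / μ.real A⌋₊ + 1))) /
        μ.real A := by
  have : IsProbabilityMeasure (ProbabilityTheory.cond μ A) :=
    ProbabilityTheory.cond_isProbabilityMeasure fun h => hA.ne' (by simp [measureReal_def, h])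
  rw [hitLE_eq_compl hA ht, probReal_compl_eq_one_sub
    (hf.measurable (measurableSet_avoid hf.measurable hAm _)),
    measureReal_def, ProbabilityTheory.cond_apply hAm, ENNReal.toReal_mul, ENNReal.toReal_inv,
    ← measureReal_def, ← measureReal_def, measureReal_inter_preimage_avoid hf hAm, inv_mul_eq_div]

end HittingTime

section Convexity

lemma mul_sub_le_sub_of_monotone {a : ℕ → ℝ} (ha : Monotone fun K => a (K + 1) - a K) (i j : ℕ) :
    ((j : ℝ) - i) * (a (i + 1) - a i) ≤ a j - a i := by
  rcases le_total i j with hij | hji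
  · induction j, hij using Nat.le_induction with
    | base => simp
    | succ j hij ih =>
      have hmono : a (i + 1) - a i ≤ a (j + 1) - a j := ha hij
      push_cast
      linarith
  · induction i, hji using Nat.le_induction with
    | base => simp
    | succ i hji ih =>
      have hmono : a (i + 1) - a i ≤ a (i + 1 + 1) - a (i + 1) := ha i.le_succ
      have hpos : (0 : ℝ) ≤ i + 1 - j := by
        rw [sub_nonneg]
        exact_mod_cast hji.trans i.le_succ
      push_cast
      linarith [mul_le_mul_of_nonneg_left hmono hpos]

variable {ι : Type*} {l : Filter ι} {c : ι → ℝ}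

lemma tendsto_floor_div_mul (hc : Tendsto c l (𝓝[>] 0)) {t : ℝ} (ht : 0 ≤ t) :
    Tendsto (fun i => (⌊t / c i⌋₊ : ℝ) * c i) l (𝓝 t) := by
  refine ((tendsto_nat_floor_mul_div_atTop ht).comp hc.inv_tendsto_nhdsGT_zero).congr fun i => ?_
  rw [Function.comp_apply, Pi.inv_apply, div_inv_eq_mul, div_eq_mul_inv]

-- Convexity of `a i` bounds its increment by difference quotients on either side.
lemma tendsto_sub_div_of_hasDerivAt {a : ι → ℕ → ℝ}
    (ha : ∀ i, Monotone fun K => a i (K + 1) - a i K) (hc : Tendsto c l (𝓝[>] 0)) {G : ℝ → ℝ}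
    {G' t : ℝ} (ht : 0 < t) (hG : HasDerivAt G G' t)
    (hlim : ∀ s > 0, Tendsto (fun i => a i ⌊s / c i⌋₊) l (𝓝 (G s))) :
    Tendsto (fun i => (a i (⌊t / c i⌋₊ + 1) - a i ⌊t / c i⌋₊) / c i) l (𝓝 G') := by
  have hgap : ∀ s > 0, Tendsto (fun i => ((⌊s / c i⌋₊ : ℝ) - ⌊t / c i⌋₊) * c i) l (𝓝 (s - t)) :=
    fun s hs => by
      simpa only [sub_mul] using
        (tendsto_floor_div_mul hc hs.le).sub (tendsto_floor_div_mul hc ht.le)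
  have hquot : ∀ s > 0, s ≠ t → Tendsto (fun i => (a i ⌊s / c i⌋₊ - a i ⌊t / c i⌋₊) /
      (((⌊s / c i⌋₊ : ℝ) - ⌊t / c i⌋₊) * c i)) l (𝓝 (slope G t s)) := fun s hs hst => by
    rw [slope_def_field]
    exact ((hlim s hs).sub (hlim t ht)).div (hgap s hs) (sub_ne_zero.2 hst)
  have htangent : ∀ s i, 0 < c i → (a i (⌊t / c i⌋₊ + 1) - a i ⌊t / c i⌋₊) / c i *
      (((⌊s / c i⌋₊ : ℝ) - ⌊t / c i⌋₊) * c i) ≤ a i ⌊s / c i⌋₊ - a i ⌊t / c i⌋₊ :=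
    fun s i hci => by
      rw [mul_comm _ (c i), ← mul_assoc, div_mul_cancel₀ _ hci.ne', mul_comm]
      exact mul_sub_le_sub_of_monotone (ha i) _ _
  have hslope := hasDerivAt_iff_tendsto_slope.1 hG
  have hcpos := hc.eventually self_mem_nhdsWithin
  refine tendsto_order.2 ⟨fun b hb => ?_, fun b hb => ?_⟩
  · obtain ⟨s, hs, hs0, hst⟩ := (((hslope.mono_left (nhdsLT_le_nhdsNE t)).eventually_const_lt
      hb).and (Ioo_mem_nhdsLT ht)).exists
    filter_upwards [(hquot s hs0 hst.ne).eventually_const_lt hs,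
      (hgap s hs0).eventually_lt_const (sub_neg.2 hst), hcpos] with i hlt hneg hci
    exact hlt.trans_le ((div_le_iff_of_neg hneg).2 (htangent s i hci))
  · obtain ⟨s, hs, hst⟩ := (((hslope.mono_left (nhdsGT_le_nhdsNE t)).eventually_lt_const
      hb).and self_mem_nhdsWithin).exists
    have hs0 : 0 < s := ht.trans hst
    filter_upwards [(hquot s hs0 hst.ne').eventually_lt_const hs,
      (hgap s hs0).eventually_const_lt (sub_pos.2 hst), hcpos] with i hlt hpos hci
    exact ((le_div_iff₀ hpos).2 (htangent s i hci)).trans_lt hlt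

end Convexity

section Statistics

variable {M : Type*} [MeasurableSpace M] {μ : Measure M} [IsProbabilityMeasure μ] {f : M → M}
  {U : ℕ → Set M} {G G' : ℝ → ℝ}

lemma hasHTS_of_tendsto_avoid (hf : MeasurePreserving f μ μ) (hU : ∀ n, MeasurableSet (U n))
    (hU0 : Tendsto (fun n => μ.real (U n)) atTop (𝓝[>] 0))
    (hlim : ∀ t : ℝ, 0 ≤ t → Tendsto (fun n => μ.real (avoid f (U n) ⌊t / μ.real (U n)⌋₊)) atTop
      (𝓝 (G t))) :
    HasHTS μ f U fun t => 1 - G t := by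
  refine ⟨?_, fun t ht => ((hlim t ht).const_sub 1).congr' ?_⟩
  · rw [← ENNReal.ofReal_zero]
    exact (ENNReal.tendsto_ofReal (hU0.mono_right nhdsWithin_le_nhds)).congr
      fun n => ofReal_measureReal
  · filter_upwards [hU0.eventually self_mem_nhdsWithin] with n hn
    exact (measureReal_hitLE hf (hU n) hn ht).symm

lemma HasHTS.hasRTS (h : HasHTS μ f U G) (hf : MeasurePreserving f μ μ)
    (hU : ∀ n, MeasurableSet (U n)) (hpos : ∀ᶠ n in atTop, 0 < μ.real (U n))
    (hG : ∀ t > 0, HasDerivAt G (G' t) t) : HasRTS μ f U fun t => 1 - G' t := by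
  have hU0 : Tendsto (fun n => μ.real (U n)) atTop (𝓝[>] 0) :=
    tendsto_nhdsWithin_iff.2 ⟨(ENNReal.tendsto_toReal ENNReal.zero_ne_top).comp h.1, hpos⟩
  have hmono : ∀ n, Monotone fun K =>
      μ.real (avoid f (U n) (K + 1)) - μ.real (avoid f (U n) K) := fun n => by
    refine monotone_nat_of_le_succ fun K => ?_
    rw [← neg_le_neg_iff, neg_sub, neg_sub, ← measureReal_inter_preimage_avoid hf (hU n),
      ← measureReal_inter_preimage_avoid hf (hU n)]
    exact measureReal_mono (inter_subset_inter_right _ (preimage_mono (antitone_avoid K.le_succ)))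
  have havoid : ∀ s > 0, Tendsto (fun n => μ.real (avoid f (U n) ⌊s / μ.real (U n)⌋₊)) atTop
      (𝓝 (1 - G s)) := fun s hs => by
    refine ((h.2 s hs.le).const_sub 1).congr' ?_
    filter_upwards [hpos] with n hn
    rw [measureReal_hitLE hf (hU n) hn hs.le, sub_sub_cancel]
  refine ⟨h.1, fun t ht => ?_⟩
  have hderiv := tendsto_sub_div_of_hasDerivAt (a := fun n K => μ.real (avoid f (U n) K))
    hmono hU0 ht ((hG t ht).const_sub 1) havoid
  simp only [sub_eq_add_neg]
  refine (hderiv.const_add 1).congr' ?_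
  filter_upwards [hpos] with n hn
  rw [cond_real_hitLE hf (hU n) hn ht.le, sub_eq_add_neg 1, ← neg_div, neg_sub]

lemma tendsto_hitLT_of_tendsto_hitLE {ν : ℕ → Measure M} [∀ n, IsFiniteMeasure (ν n)]
    (hpos : ∀ᶠ n in atTop, 0 < μ.real (U n))
    (hlim : ∀ t > 0, Tendsto (fun n => (ν n).real (hitLE μ f (U n) t)) atTop (𝓝 (G t)))
    {t : ℝ} (ht : 0 < t) (hG : ContinuousAt G t) :
    Tendsto (fun n => (ν n).real (hitLT μ f (U n) t)) atTop (𝓝 (G t)) := by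
  refine tendsto_order.2 ⟨fun b hb => ?_, fun b hb => ?_⟩
  · obtain ⟨s, hs, hs0, hst⟩ :=
      (((hG.mono_left nhdsWithin_le_nhds).eventually_const_lt hb).and (Ioo_mem_nhdsLT ht)).exists
    filter_upwards [(hlim s hs0).eventually_const_lt hs, hpos] with n hn hUn
    exact hn.trans_le (measureReal_mono (hitLE_subset_hitLT hUn hs0.le hst))
  · filter_upwards [(hlim t ht).eventually_lt_const hb] with n hn
    exact (measureReal_mono (hitLT_subset_hitLE t)).trans_lt hn

lemma HasHTS.tendsto_hitLT (h : HasHTS μ f U G) (hpos : ∀ᶠ n in atTop, 0 < μ.real (U n))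
    (hG : Continuous G) (hG0 : G 0 = 0) {t : ℝ} (ht : 0 ≤ t) :
    Tendsto (fun n => μ.real (hitLT μ f (U n) t)) atTop (𝓝 (G t)) := by
  rcases ht.eq_or_lt with rfl | ht
  · simp [hitLT_zero, hG0]
  · exact tendsto_hitLT_of_tendsto_hitLE hpos (fun s hs => h.2 s hs.le) ht hG.continuousAt

lemma HasRTS.tendsto_hitLT (h : HasRTS μ f U G) (hpos : ∀ᶠ n in atTop, 0 < μ.real (U n))
    (hG : Continuous G) {t : ℝ} (ht : 0 < t) :
    Tendsto (fun n => (ProbabilityTheory.cond μ (U n)).real (hitLT μ f (U n) t)) atTop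
      (𝓝 (G t)) :=
  tendsto_hitLT_of_tendsto_hitLE hpos h.2 ht hG.continuousAt

end Statistics

section Observable

variable {M : Type*} {f : M → M} {ζ : M} {g : ℝ → EReal}

lemma escape_process_eq_preimage_exitSet [Dist M] (p i : ℕ) (u : ℝ) :
    escape (process f ζ g) p i u =
      f^[i] ⁻¹' exitSet f^[p] {x | (u : EReal) < process f ζ g 0 x} := by
  ext x
  simp only [escape, exitSet, process, mem_preimage, Set.mem_sdiff, mem_ofPred_eq,
    Function.iterate_zero_apply, ← Function.iterate_add_apply, add_comm p i, not_lt]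

lemma noEscape_process_eq_preimage_avoid [Dist M] (p s ℓ : ℕ) (u : ℝ) :
    noEscape (process f ζ g) p s ℓ u =
      f^[s] ⁻¹' avoid f (exitSet f^[p] {x | (u : EReal) < process f ζ g 0 x}) ℓ := by
  ext x
  simp only [noEscape, avoid, escape_process_eq_preimage_exitSet, mem_iInter, Finset.mem_Ico,
    mem_compl_iff, mem_preimage, mem_ofPred_eq, ← Function.iterate_add_apply]
  refine ⟨fun h i hi => h (i + s) (by omega), fun h i hi => ?_⟩
  simpa only [Nat.sub_add_cancel hi.1] using h (i - s) (by omega)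

lemma exists_mixesWithoutClustering [Dist M] [MeasurableSpace M] {μ : Measure M} {p : ℕ}
    {u : ℕ → ℝ} {T : ℕ → ℕ} (hD : CondDp μ (process f ζ g) p u T)
    (hD' : CondDp' μ (process f ζ g) p u T)
    (hm : ∀ᶠ n in atTop,
      MeasurableSet (exitSet f^[p] {x | (u n : EReal) < process f ζ g 0 x})) :
    ∃ k γ, MixesWithoutClustering μ f
      (fun n => exitSet f^[p] {x | (u n : EReal) < process f ζ g 0 x}) T k γ := by
  obtain ⟨-, γ, hγ_anti, hγ, hmix⟩ := hD
  obtain ⟨k, hk, hkT, hrec⟩ := hD'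
  simp only [escape_process_eq_preimage_exitSet, noEscape_process_eq_preimage_avoid,
    Function.iterate_zero, preimage_id] at hmix hrec
  exact ⟨k, fun n => γ n (T n), hm, .of_forall fun n ℓ t ht => (hmix n t ℓ).trans (hγ_anti n ht),
    hγ, hk, hkT.tendsto_div_nhds_zero, hrec⟩

lemma IsPeak.exists_superlevel_cases [PseudoMetricSpace M] (hg : IsPeak g) (f : M → M) (ζ : M) :
    ∃ ε > 0, ∀ v : EReal, Metric.ball ζ ε ⊆ {x | v < process f ζ g 0 x} ∨
      (∃ r > 0, {x | v < process f ζ g 0 x} = Metric.ball ζ r) ∨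
      {x | v < process f ζ g 0 x} = ∅ := by
  obtain ⟨ε, hε, w, hw, hanti, hbij, hout⟩ := hg
  have hmem : ∀ x ∈ Metric.ball ζ ε, dist x ζ ∈ Ico 0 ε := fun x hx => ⟨dist_nonneg, hx⟩
  refine ⟨ε, hε, fun v => ?_⟩
  rcases le_or_gt v w with hvw | hwv
  · exact .inl fun x hx => hvw.trans_lt (hbij.mapsTo (hmem x hx)).1
  rcases lt_or_ge v (g 0) with hv0 | h0v
  · obtain ⟨r, hr, rfl⟩ := hbij.surjOn ⟨hwv, hv0.le⟩
    have hr0 : r ≠ 0 := fun h => hv0.ne (congrArg g h)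
    refine .inr (.inl ⟨r, hr.1.lt_of_ne' hr0, ext fun x => ?_⟩)
    rcases lt_or_ge (dist x ζ) ε with hx | hx
    · exact hanti.lt_iff_gt hr (hmem x hx)
    · exact iff_of_false (not_lt.2 ((hout _ hx).trans hwv.le)) (not_lt.2 (hr.2.le.trans hx))
  · refine .inr (.inr (eq_empty_of_forall_notMem fun x => not_lt.2 (le_trans ?_ h0v)))
    rcases lt_or_ge (dist x ζ) ε with hx | hx
    · exact (hbij.mapsTo (hmem x hx)).2
    · exact (hout _ hx).trans hw.le

lemma IsPeak.exists_radius [PseudoMetricSpace M] [MeasurableSpace M] {μ : Measure M}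
    [IsFiniteMeasure μ] (hg : IsPeak g)
    (hball : ∀ r : ℝ, 0 < r → 0 < μ.real (Metric.ball ζ r)) {u : ℕ → ℝ} {τ : ℝ} (hτ : 0 < τ)
    (hu : Tendsto (fun n : ℕ => (n : ℝ) * μ.real {x | (u n : EReal) < process f ζ g 0 x})
      atTop (𝓝 τ)) :
    ∃ r : ℕ → ℝ, Tendsto r atTop (𝓝[>] 0) ∧
      ∀ᶠ n in atTop, {x | (u n : EReal) < process f ζ g 0 x} = Metric.ball ζ (r n) := by
  obtain ⟨ε, hε, hcases⟩ := hg.exists_superlevel_cases f ζ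
  have hzero := tendsto_zero_of_tendsto_natCast_mul hu
  have hexists : ∀ᶠ n in atTop, ∃ r > 0,
      {x | (u n : EReal) < process f ζ g 0 x} = Metric.ball ζ r := by
    filter_upwards [hzero.eventually_lt_const (hball ε hε), hu.eventually_const_lt hτ]
      with n hlt hpos
    refine ((hcases (u n)).resolve_left fun hsub => ?_).resolve_right fun hempty => ?_
    · exact hlt.not_ge (measureReal_mono hsub)
    · simp only [hempty, measureReal_empty, mul_zero, lt_irrefl] at hpos
  obtain ⟨r, hr⟩ := hexists.choice
  refine ⟨r, tendsto_nhdsWithin_iff.2 ⟨tendsto_order.2 ⟨fun b hb => ?_, fun b hb => ?_⟩,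
    hr.mono fun n hn => hn.1⟩, hr.mono fun n hn => hn.2⟩
  · filter_upwards [hr] with n hn using hb.trans hn.1
  · filter_upwards [hr, hzero.eventually_lt_const (hball b hb)] with n hn hlt
    rw [hn.2] at hlt
    by_contra hb
    exact hlt.not_ge (measureReal_mono (Metric.ball_subset_ball (not_lt.1 hb)))

lemma IsPeak.exists_mixesWithoutClustering_ball [PseudoMetricSpace M] [MeasurableSpace M]
    [OpensMeasurableSpace M] {μ : Measure M} [IsFiniteMeasure μ] (hg : IsPeak g)
    (hf : Measurable f) (hball : ∀ r : ℝ, 0 < r → 0 < μ.real (Metric.ball ζ r)) {p : ℕ}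
    {u : ℕ → ℝ} {T : ℕ → ℕ} {τ : ℝ} (hτ : 0 < τ)
    (hu : Tendsto (fun n : ℕ => (n : ℝ) * μ.real {x | (u n : EReal) < process f ζ g 0 x})
      atTop (𝓝 τ))
    (hD : CondDp μ (process f ζ g) p u T) (hD' : CondDp' μ (process f ζ g) p u T) :
    ∃ r : ℕ → ℝ, Tendsto r atTop (𝓝[>] 0) ∧
      Tendsto (fun n : ℕ => (n : ℝ) * μ.real (Metric.ball ζ (r n))) atTop (𝓝 τ) ∧
      ∃ k γ, MixesWithoutClustering μ f (fun n => exitSet f^[p] (Metric.ball ζ (r n))) T k γ := by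
  obtain ⟨r, hr, hlevel⟩ := hg.exists_radius hball hτ hu
  refine ⟨r, hr, hu.congr' (hlevel.mono fun n hn => by rw [hn]), ?_⟩
  obtain ⟨k, γ, hmix⟩ := exists_mixesWithoutClustering hD hD' <| by
    filter_upwards [hlevel] with n hn
    rw [hn]
    exact measurableSet_exitSet (hf.iterate p) Metric.isOpen_ball.measurableSet
  exact ⟨k, γ, hmix.congr (hlevel.mono fun n hn => congrArg (exitSet f^[p]) hn)⟩

end Observable

section Comparison

variable {M : Type*} [MeasurableSpace M] {μ : Measure M} [IsProbabilityMeasure μ] {f : M → M}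
  {A : ℕ → Set M} {p : ℕ} {T k : ℕ → ℕ} {γ : ℕ → ℝ} {τ κ : ℝ} {ι : Type*} {l : Filter ι}

lemma MixesWithoutClustering.tendsto_measureReal_avoid_of_exitSet
    (h : MixesWithoutClustering μ f (fun n => exitSet f^[p] (A n)) T k γ)
    (hf : MeasurePreserving f μ μ) (hA : ∀ n, MeasurableSet (A n)) (hp : 0 < p) (hκ : 0 < κ)
    (hexit : Tendsto (fun n : ℕ => (n : ℝ) * μ.real (exitSet f^[p] (A n))) atTop (𝓝 κ))
    (hA0 : Tendsto (fun n => μ.real (A n)) atTop (𝓝 0)) {m N : ι → ℕ} {s : ℝ} (hs : 0 ≤ s)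
    (hm : Tendsto m l atTop) (hN : Tendsto (fun i => (N i : ℝ) / m i) l (𝓝 s)) :
    Tendsto (fun i => μ.real (avoid f (A (m i)) (N i))) l (𝓝 (Real.exp (-(s * κ)))) := by
  have herror : Tendsto (fun i => (p : ℝ) * μ.real (A (m i))) l (𝓝 0) := by
    simpa only [mul_zero, Function.comp_apply] using (hA0.comp hm).const_mul (p : ℝ)
  have hdiff : Tendsto (fun i => μ.real (avoid f (A (m i)) (N i)) -
      μ.real (avoid f (exitSet f^[p] (A (m i))) (N i))) l (𝓝 0) :=
    squeeze_zero_norm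
      (fun i => abs_measureReal_avoid_sub_avoid_exitSet_le hf (hA _) hp _) herror
  simpa only [sub_add_cancel, zero_add] using
    hdiff.add (h.tendsto_measureReal_avoid hf hκ hexit hs hm hN)

lemma tendsto_measureReal_avoid_sub_avoid (hf : MeasurePreserving f μ μ) {B C : ι → Set M}
    (hB : ∀ i, MeasurableSet (B i)) (hC : ∀ i, MeasurableSet (C i))
    (hBC : ∀ i, B i ⊆ C i ∨ C i ⊆ B i) (hpos : ∀ᶠ i in l, μ.real (B i) ≠ 0)
    (hratio : Tendsto (fun i => μ.real (C i) / μ.real (B i)) l (𝓝 1)) {N : ι → ℕ} {t : ℝ}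
    (hN : Tendsto (fun i => (N i : ℝ) * μ.real (B i)) l (𝓝 t)) :
    Tendsto (fun i => μ.real (avoid f (B i) (N i)) - μ.real (avoid f (C i) (N i))) l (𝓝 0) := by
  have herror := hN.mul (hratio.const_sub 1).abs
  rw [sub_self, abs_zero, mul_zero] at herror
  refine squeeze_zero_norm' ?_ herror
  filter_upwards [hpos] with i hi
  refine (abs_measureReal_avoid_sub_avoid_le_abs_sub hf (hB i) (hC i) (hBC i) _).trans_eq ?_
  rw [one_sub_div hi, abs_div, abs_of_nonneg (measureReal_nonneg (μ := μ) (s := B i)), mul_assoc,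
    mul_div_cancel₀ _ hi]

-- `B i` is compared with `A n` for `n = ⌊τ / μ (B i)⌋₊`, the index at which their measures agree.
lemma MixesWithoutClustering.tendsto_measureReal_avoid_of_nested
    (h : MixesWithoutClustering μ f (fun n => exitSet f^[p] (A n)) T k γ)
    (hf : MeasurePreserving f μ μ) (hA : ∀ n, MeasurableSet (A n)) (hp : 0 < p) (hτ : 0 < τ)
    {θ : ℝ} (hθ : 0 < θ)
    (hexit : Tendsto (fun n : ℕ => (n : ℝ) * μ.real (exitSet f^[p] (A n))) atTop (𝓝 (τ * θ)))
    (hAτ : Tendsto (fun n : ℕ => (n : ℝ) * μ.real (A n)) atTop (𝓝 τ)) {B : ι → Set M}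
    (hB : ∀ i, MeasurableSet (B i)) (hBA : ∀ i n, B i ⊆ A n ∨ A n ⊆ B i)
    (hB0 : Tendsto (fun i => μ.real (B i)) l (𝓝[>] 0)) {t : ℝ} (ht : 0 ≤ t) :
    Tendsto (fun i => μ.real (avoid f (B i) ⌊t / μ.real (B i)⌋₊)) l
      (𝓝 (Real.exp (-θ * t))) := by
  let m : ι → ℕ := fun i => ⌊τ / μ.real (B i)⌋₊
  have hpos : ∀ᶠ i in l, μ.real (B i) ≠ 0 :=
    (hB0.eventually self_mem_nhdsWithin).mono fun _ h => ne_of_gt h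
  have hm : Tendsto m l atTop := tendsto_nat_floor_atTop.comp
    ((hB0.inv_tendsto_nhdsGT_zero.const_mul_atTop hτ).congr fun i => (div_eq_mul_inv _ _).symm)
  have hmB : Tendsto (fun i => (m i : ℝ) * μ.real (B i)) l (𝓝 τ) :=
    tendsto_floor_div_mul hB0 hτ.le
  have hNB := tendsto_floor_div_mul hB0 ht
  have hNm : Tendsto (fun i => (⌊t / μ.real (B i)⌋₊ : ℝ) / m i) l (𝓝 (t / τ)) := by
    refine (hNB.div hmB hτ.ne').congr' ?_
    filter_upwards [hpos] with i hi using mul_div_mul_right _ _ hi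
  have hratio : Tendsto (fun i => μ.real (A (m i)) / μ.real (B i)) l (𝓝 1) := by
    rw [← div_self hτ.ne']
    refine ((hAτ.comp hm).div hmB hτ.ne').congr' ?_
    filter_upwards [hm.eventually_ne_atTop 0] with i hi
    exact mul_div_mul_left _ _ (Nat.cast_ne_zero.2 hi)
  have hlim := h.tendsto_measureReal_avoid_of_exitSet hf hA hp (mul_pos hτ hθ) hexit
    (tendsto_zero_of_tendsto_natCast_mul hAτ) (div_nonneg ht hτ.le) hm hNm
  have hdiff := tendsto_measureReal_avoid_sub_avoid hf hB (fun i => hA (m i))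
    (fun i => hBA i (m i)) hpos hratio hNB
  have hexponent : -(t / τ * (τ * θ)) = -θ * t := by field_simp
  simpa only [sub_add_cancel, zero_add, hexponent] using hdiff.add hlim

end Comparison

section RepellingPeriodicPoint

variable {d : ℕ} {H : Type*} [TopologicalSpace H]
  {I : ModelWithCorners ℝ (EuclideanSpace ℝ (Fin d)) H} {M : Type*} [MetricSpace M]
  [ChartedSpace H M] {f : M → M} {p : ℕ} {ζ : M} {L : TangentSpace I ζ ≃L[ℝ] TangentSpace I ζ}

lemma IsRepellingPeriodicPoint.isFixedPt (h : IsRepellingPeriodicPoint I f p ζ L) :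
    Function.IsFixedPt f^[p] ζ :=
  h.minimalPeriod_eq ▸ Function.isPeriodicPt_minimalPeriod f ζ

lemma IsRepellingPeriodicPoint.dim_pos (h : IsRepellingPeriodicPoint I f p ζ L) : 0 < d := by
  refine Nat.pos_of_ne_zero fun hd => h.abs_det_lt.ne ?_
  rw [ContinuousLinearMap.det, LinearMap.det_eq_one_of_finrank_eq_zero, abs_one]
  exact (finrank_euclideanSpace_fin (𝕜 := ℝ) (n := d)).trans hd

variable [IsManifold I 1 M]
  [Bundle.RiemannianBundle (fun x : M => TangentSpace I x)]
  [IsContinuousRiemannianBundle (EuclideanSpace ℝ (Fin d)) (fun x : M => TangentSpace I x)]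
  [IsRiemannianManifold I M] [MeasurableSpace M] [BorelSpace M] {μ : Measure M}
  [IsProbabilityMeasure μ] {c τ : ℝ} {r : ℕ → ℝ} {T k : ℕ → ℕ} {γ : ℕ → ℝ}

lemma IsRepellingPeriodicPoint.tendsto_mul_measureReal_exitSet
    (h : IsRepellingPeriodicPoint I f p ζ L) (hμ : HasTangentDensity I μ ζ c) (hc : 0 < c)
    (hζ : I.IsInteriorPoint ζ) (hf : Measurable f)
    (hmix : MixesWithoutClustering μ f (fun n => exitSet f^[p] (Metric.ball ζ (r n))) T k γ)
    (hr : Tendsto r atTop (𝓝[>] 0)) (hτ : 0 < τ)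
    (hrτ : Tendsto (fun n : ℕ => (n : ℝ) * μ.real (Metric.ball ζ (r n))) atTop (𝓝 τ)) :
    Tendsto (fun n : ℕ => (n : ℝ) * μ.real (exitSet f^[p] (Metric.ball ζ (r n)))) atTop
      (𝓝 (τ * (1 - |(L.symm : TangentSpace I ζ →L[ℝ] TangentSpace I ζ).det|))) := by
  have hscale : ∀ κ, Tendsto (fun r => μ.real (exitSet f^[p] (Metric.ball ζ r)) /
      μ.real (Metric.ball ζ r)) (𝓝[>] 0) (𝓝 κ) →
      Tendsto (fun n : ℕ => (n : ℝ) * μ.real (exitSet f^[p] (Metric.ball ζ (r n)))) atTop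
        (𝓝 (τ * κ)) := fun κ hκ => by
    refine (hrτ.mul (hκ.comp hr)).congr' ?_
    filter_upwards [hr.eventually self_mem_nhdsWithin] with n hn
    rw [Function.comp_apply, mul_assoc, mul_div_cancel₀ _ (hμ.measureReal_ball_pos hc hζ hn).ne']
  obtain ⟨κ, hκ, hproportion⟩ := hμ.exists_tendsto_measureReal_exitSet_div hc hζ
    (hf.iterate p) h.isFixedPt h.hasMFDerivAt
  have hκ0 : 0 < κ := (sub_pos.2 h.abs_det_lt).trans_le hκ
  refine hscale _ (hμ.tendsto_measureReal_exitSet_div hc hζ (hf.iterate p) h.isFixedPt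
    h.hasMFDerivAt h.abs_det_lt h.contracting hr fun j hj => ?_)
  have hreturn := (hmix.tendsto_mul_inter_preimage (mul_pos hτ hκ0) (hscale κ hproportion)
    (Nat.mul_pos h.period_pos hj)).div hrτ hτ.ne'
  rw [zero_div] at hreturn
  refine hreturn.congr' ?_
  filter_upwards [eventually_ne_atTop 0] with n hn
  rw [← Function.iterate_mul]
  exact mul_div_mul_left _ _ (Nat.cast_ne_zero.2 hn)

lemma IsRepellingPeriodicPoint.tendsto_measureReal_avoid_ball
    (h : IsRepellingPeriodicPoint I f p ζ L) (hμ : HasTangentDensity I μ ζ c) (hc : 0 < c)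
    (hζ : I.IsInteriorPoint ζ) (hf : MeasurePreserving f μ μ)
    (hmix : MixesWithoutClustering μ f (fun n => exitSet f^[p] (Metric.ball ζ (r n))) T k γ)
    (hr : Tendsto r atTop (𝓝[>] 0)) (hτ : 0 < τ)
    (hrτ : Tendsto (fun n : ℕ => (n : ℝ) * μ.real (Metric.ball ζ (r n))) atTop (𝓝 τ))
    {ι : Type*} {l : Filter ι} {δ : ι → ℝ}
    (hδ : Tendsto (fun i => μ.real (Metric.ball ζ (δ i))) l (𝓝[>] 0)) {t : ℝ} (ht : 0 ≤ t) :
    Tendsto (fun i => μ.real (avoid f (Metric.ball ζ (δ i)) ⌊t / μ.real (Metric.ball ζ (δ i))⌋₊)) l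
      (𝓝 (Real.exp (-(1 - |(L.symm : TangentSpace I ζ →L[ℝ] TangentSpace I ζ).det|) * t))) :=
  hmix.tendsto_measureReal_avoid_of_nested hf (fun _ => Metric.isOpen_ball.measurableSet)
    h.period_pos hτ (sub_pos.2 h.abs_det_lt)
    (h.tendsto_mul_measureReal_exitSet hμ hc hζ hf.measurable hmix hr hτ hrτ) hrτ
    (fun _ => Metric.isOpen_ball.measurableSet)
    (fun i n => (le_total (δ i) (r n)).imp Metric.ball_subset_ball Metric.ball_subset_ball) hδ ht

end RepellingPeriodicPoint

end HittingTimes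

end

theorem corollary3p2
    {d : ℕ} {H : Type*} [TopologicalSpace H]
    (I : ModelWithCorners ℝ (EuclideanSpace ℝ (Fin d)) H)
    {M : Type*} [MetricSpace M] [SecondCountableTopology M] [ChartedSpace H M] [IsManifold I 1 M]
    [Bundle.RiemannianBundle (fun x : M => TangentSpace I x)]
    [IsContinuousRiemannianBundle (EuclideanSpace ℝ (Fin d)) (fun x : M => TangentSpace I x)]
    [IsRiemannianManifold I M]
    [MeasurableSpace M] [BorelSpace M]
    -- the reference measure and the dynamical system
    (Leb : Measure M) (hLeb : HittingTimes.IsVolumeMeasure I Leb)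
    (μ : Measure M) [IsProbabilityMeasure μ] (f : M → M) (hf : MeasurePreserving f μ μ)
    (hμ : μ ≪ Leb)
    -- the repelling periodic point, a Lebesgue point of positive finite density
    (p : ℕ) (ζ : M) (hζ : I.IsInteriorPoint ζ)
    (L : TangentSpace I ζ ≃L[ℝ] TangentSpace I ζ)
    (hrep : HittingTimes.IsRepellingPeriodicPoint I f p ζ L)
    (ρ : ℝ) (hρ : 0 < ρ) (hdens : HittingTimes.IsLebesguePoint μ Leb ζ ρ)
    (θ : ℝ) (hθ : θ = 1 - |(L.symm : TangentSpace I ζ →L[ℝ] TangentSpace I ζ).det|)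
    -- the observable, the levels and the mixing conditions
    (g : ℝ → EReal) (hg : HittingTimes.IsPeak g)
    (u : ℕ → ℝ) (τ : ℝ) (hτ : 0 < τ)
    (hu : Tendsto
      (fun n : ℕ => (n : ℝ) * μ.real {x | (u n : EReal) < HittingTimes.process f ζ g 0 x})
      atTop (𝓝 τ))
    (T : ℕ → ℕ)
    (hD : HittingTimes.CondDp μ (HittingTimes.process f ζ g) p u T)
    (hD' : HittingTimes.CondDp' μ (HittingTimes.process f ζ g) p u T)
    -- the radii
    (δ : ℕ → ℝ) (hδ : ∀ n, 0 < δ n) (hδ0 : Tendsto δ atTop (𝓝 0)) :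
    HittingTimes.HasHTS μ f (fun n => Metric.ball ζ (δ n)) (fun t => 1 - Real.exp (-θ * t)) ∧
    HittingTimes.HasRTS μ f (fun n => Metric.ball ζ (δ n))
      (fun t => (1 - θ) + θ * (1 - Real.exp (-θ * t))) ∧
    (∀ t : ℝ, 0 ≤ t → Tendsto
      (fun n => μ.real (HittingTimes.hitLT μ f (Metric.ball ζ (δ n)) t))
      atTop (𝓝 (1 - Real.exp (-θ * t)))) ∧
    (∀ t : ℝ, 0 < t → Tendsto
      (fun n => (ProbabilityTheory.cond μ (Metric.ball ζ (δ n))).real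
        (HittingTimes.hitLT μ f (Metric.ball ζ (δ n)) t))
      atTop (𝓝 ((1 - θ) + θ * (1 - Real.exp (-θ * t))))) := by
  have := hLeb.isLocallyFiniteMeasure
  obtain ⟨c, hc, hLebc⟩ := hLeb.exists_hasTangentDensity hζ
  have hμc := hdens.hasTangentDensity hμ hρ.le hLebc hc hζ
  have hρc : 0 < ρ * c := mul_pos hρ hc
  have hball := fun s (hs : 0 < s) => hμc.measureReal_ball_pos hρc hζ hs
  have hpos : ∀ᶠ n in atTop, 0 < μ.real (Metric.ball ζ (δ n)) := .of_forall fun n => hball _ (hδ n)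
  have hshrink : Tendsto (fun n => μ.real (Metric.ball ζ (δ n))) atTop (𝓝[>] 0) :=
    tendsto_nhdsWithin_iff.2 ⟨(hμc.tendsto_measureReal_ball hζ hrep.dim_pos).comp
      (tendsto_nhdsWithin_iff.2 ⟨hδ0, .of_forall hδ⟩), hpos⟩
  obtain ⟨r, hr, hrτ, k, γ, hmix⟩ :=
    hg.exists_mixesWithoutClustering_ball hf.measurable hball hτ hu hD hD'
  have hball_meas : ∀ n, MeasurableSet (Metric.ball ζ (δ n)) :=
    fun n => Metric.isOpen_ball.measurableSet
  have hHTS := HittingTimes.hasHTS_of_tendsto_avoid hf hball_meas hshrink fun t ht =>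
    hθ ▸ hrep.tendsto_measureReal_avoid_ball hμc hρc hζ hf hmix hr hτ hrτ hshrink ht
  have hderiv : ∀ t > 0, HasDerivAt (fun t => 1 - Real.exp (-θ * t)) (θ * Real.exp (-θ * t)) t :=
    fun t _ => by simpa [mul_comm] using ((hasDerivAt_id t).const_mul (-θ)).exp.const_sub 1
  have hRTS := hHTS.hasRTS hf hball_meas hpos hderiv
  simp only [fun t => show 1 - θ * Real.exp (-θ * t) =
    (1 - θ) + θ * (1 - Real.exp (-θ * t)) by ring] at hRTS
  exact ⟨hHTS, hRTS, fun t ht => hHTS.tendsto_hitLT hpos (by fun_prop) (by simp) ht,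
    fun t ht => hRTS.tendsto_hitLT hpos (by fun_prop) ht⟩
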